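/- **Setting.** For an $n\times m$ integer matrix $C=(c_{ik})$ with $n\ge m$ and no zero rows, let $l_i(u)=\sum_{k} c_{ik}u_k$ be the linear forms given by its rows, and let $S_C\subseteq\mathbb C^m$ be the Zariski closure of the image of the rational map $$\psi_C:\mathbb C^m\dashrightarrow\mathbb C^m,\qquad \psi_C(u)_k=\prod_{i=1}^n l_i(u)^{c_{ik}}\quad(k=1,\dots,m).$$ $C$ is called *regular* if each of its columns sums to $0$, and *non-defective* if $S_C$ has codimension $1$ in $\mathbb C^m$. In that case $\Delta_C\in\mathbb Z[y_1,\dots,y_m]$ denotes an irreducible equation of $S_C$ with integer coefficients and content $1$ (it is defined up to sign): $\Delta_C$ is irreducible in $\mathbb C[y_1,\dots,y_m]$, its zero set in $\mathbb C^m$ is $S_C$, and the gcd of its coefficients is $1$. For $M\in\mathbb Z^{m\times m}$ let $\alpha_M:(\mathbb C^*)^m\to(\mathbb C^*)^m$, $\alpha_M(y)_k=\prod_{i=1}^m y_i^{M_{ik}}$, let $G_M=\{\varepsilon\in(\mathbb C^*)^m:\alpha_M(\varepsilon)=(1,\dots,1)\}$ with coordinatewise multiplication, and let $\mathbb ZM\subseteq\mathbb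 Z^m$ be the lattice spanned by the columns of $M$. **Theorem.** Let $C_1,C_2$ be non-defective regular $n\times m$ integer matrices without zero rows, $n\ge m$, such that $C_1=C_2\cdot M$ for some $M\in\mathbb Z^{m\times m}$. Then the group $G_M$ is finite, the polynomials $\Delta_{C_1}$ and $\Delta_{C_2}$ exist, and, whatever the choice of their signs: 1. There is a vector $v\in\mathbb ZM$ such that, in the Laurent polynomial ring $\mathbb C[y_1^{\pm1},\dots,y_m^{\pm1}]$, $$\Delta_{C_1}(\alpha_M(y))=\pm\,y^v\prod_{\varepsilon\in G_M}\Delta_{C_2}(\varepsilon\cdot y).$$ 2. The polynomials $\Delta_{C_2}(\varepsilon\cdot y)$, $\varepsilon\in G_M$, are pairwise coprime in $\mathbb C[y_1,\dots,y_m]$, and each of them divides $\Delta_{C_1}(\alpha_M(y))$ with multiplicity exactly one in the Laurent polynomial ring. Moreover, a vector $w\in\mathbb Z^m$ lies in $\mathbb ZM$ if and only if $\varepsilon^w=1$ for all $\varepsilon\in G_M$. -/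

import Mathlib

namespace HornKapranov

open MvPolynomial

variable {n m : ℕ}

/-- The linear form `l_i(u) = ⟨C_i, u⟩` given by the `i`-th row of `C`. -/
def linearForm (C : Matrix (Fin n) (Fin m) ℤ) (i : Fin n) (u : Fin m → ℂ) : ℂ :=
  ∑ k, (C i k : ℂ) * u k

/-- The Horn–Kapranov parametrization `ψ_C`, with coordinates `y_k = ∏ i, l_i(u) ^ c_{ik}`;
it is only used where no `l_i` vanishes. -/
noncomputable def psi (C : Matrix (Fin n) (Fin m) ℤ) (u : Fin m → ℂ) : Fin m → ℂ :=
  fun k => ∏ i, linearForm C i u ^ C i k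

/-- The image of `ψ_C` on the complement of the hyperplanes `l_i = 0`. When `C` has no zero row
this complement is a nonempty Zariski open set, hence dense in every domain of definition of the
rational map `ψ_C`, so that the closure of the image does not depend on this choice. -/
def psiImage (C : Matrix (Fin n) (Fin m) ℤ) : Set (Fin m → ℂ) :=
  psi C '' {u | ∀ i, linearForm C i u ≠ 0}

/-- `S_C ⊆ ℂ^m`: the Zariski closure of the image of `ψ_C`. -/
def S (C : Matrix (Fin n) (Fin m) ℤ) : Set (Fin m → ℂ) :=
  zeroLocus ℂ (vanishingIdeal ℂ (psiImage C))

/-- `C` is regular: each of its columns sums to zero (its row vectors add up to `0`). -/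
def IsRegular (C : Matrix (Fin n) (Fin m) ℤ) : Prop :=
  ∀ k, ∑ i, C i k = 0

/-- `C` is non-defective: `S_C` has codimension one in `ℂ^m`. The codimension of an irreducible
closed set is the height of its (prime) vanishing ideal. -/
def NonDefective (C : Matrix (Fin n) (Fin m) ℤ) : Prop :=
  (vanishingIdeal ℂ (S C) : Ideal (MvPolynomial (Fin m) ℂ)).height = 1

/-- The image in `ℂ[y]` of a polynomial with integer coefficients. -/
noncomputable def toComplex (Δ : MvPolynomial (Fin m) ℤ) : MvPolynomial (Fin m) ℂ :=
  map (Int.castRingHom ℂ) Δ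

/-- `Δ` is a generalized inhomogeneous discriminant `Δ_C`: an irreducible equation of `S_C` with
integer coefficients and content `1`. (This determines `Δ` up to sign.) -/
def IsDiscriminant (C : Matrix (Fin n) (Fin m) ℤ) (Δ : MvPolynomial (Fin m) ℤ) : Prop :=
  Irreducible (toComplex Δ) ∧
  {y : Fin m → ℂ | eval y (toComplex Δ) = 0} = S C ∧
  (Δ.support.gcd fun a => Δ.coeff a) = 1

/-- The monomial map `α_M : (ℂ^*)^m → (ℂ^*)^m`, `α_M(y)_k = ∏ i, y_i ^ M_{ik}`. -/
def alpha (M : Matrix (Fin m) (Fin m) ℤ) : (Fin m → ℂˣ) →* (Fin m → ℂˣ) where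
  toFun y := fun k => ∏ i, y i ^ M i k
  map_one' := by funext k; simp
  map_mul' x y := by funext k; simp [mul_zpow, Finset.prod_mul_distrib]

/-- The group `G_M = {ε ∈ (ℂ^*)^m : α_M(ε) = 1}`. -/
def G (M : Matrix (Fin m) (Fin m) ℤ) : Subgroup (Fin m → ℂˣ) :=
  (alpha M).ker

/-- The lattice `ℤM ⊆ ℤ^m` spanned by the columns of `M`. -/
def columnLattice (M : Matrix (Fin m) (Fin m) ℤ) : Submodule ℤ (Fin m → ℤ) :=
  Submodule.span ℤ (Set.range M.col)

/-- The Laurent polynomial ring `ℂ[y_1^{±1}, …, y_m^{±1}]`. -/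
abbrev Laurent (m : ℕ) : Type := AddMonoidAlgebra ℂ (Fin m → ℤ)

/-- The Laurent monomial `y^v`. -/
noncomputable def mono (v : Fin m → ℤ) : Laurent m :=
  AddMonoidAlgebra.single v 1

/-- The inclusion of `ℂ[y_1, …, y_m]` into the Laurent polynomial ring. -/
noncomputable def toLaurent : MvPolynomial (Fin m) ℂ →ₐ[ℂ] Laurent m :=
  aeval fun k => mono (Pi.single k 1)

/-- `f ↦ f ∘ α_M`: substitute `y^{M^{(k)}}` for `y_k`, with `M^{(k)}` the `k`-th column of `M`. -/
noncomputable def compAlpha (M : Matrix (Fin m) (Fin m) ℤ) :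
    MvPolynomial (Fin m) ℂ →ₐ[ℂ] Laurent m :=
  aeval fun k => mono (M.col k)

/-- The polynomial `f(ε · y)`, for the coordinatewise action of `ε` in the torus. -/
noncomputable def scale (ε : Fin m → ℂˣ) :
    MvPolynomial (Fin m) ℂ →ₐ[ℂ] MvPolynomial (Fin m) ℂ :=
  aeval fun k => C (ε k : ℂ) * X k

end HornKapranov

/-! Everything is tested at the generic point `psiAt C coord` of S_C, whose coordinates lie in ℂ(u):
the vanishing ideal of S_C is the kernel of f ↦ f(ψ_C(u)), a height-one prime of a UFD, hence
generated by one irreducible Δ. Since ψ_{CM}(u) = α_M(ψ_C(Mu)) and u ↦ Mu is invertible, f vanishes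
generically on S_{CM} iff f ∘ α_M does on S_C (`pullback_mul_eq_zero_iff`). So Δ₂ divides Δ₁ ∘ α_M,
and by G_M-invariance of the latter so does every translate Δ₂(εy). Once the translates are coprime,
their product P divides Δ₁ ∘ α_M. Conversely P is G_M-invariant, so by the duality between G_M and
ℤM it is a Laurent polynomial in α_M(y); it vanishes at the generic point of S_{C₂}, so Δ₁ ∘ α_M
divides P. The two differ by a Laurent unit c·y^v, and v ∈ ℤM because both supports lie in ℤM
(`exists_unit_factorization`).

Coprimality rests on the fact that the logarithmic Gauss map inverts ψ_C
(`exists_pullback_theta_eq`). The logarithmic Jacobian of ψ_C is symmetric and its kernel is the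
line spanned by u; differentiating Δ(ψ_C(u)) = 0 puts the vector of y_k ∂Δ/∂y_k in that kernel.
Hence y is recovered from ratios of logarithmic derivatives of Δ, and Δ(εy) = cΔ(y) forces ε = 1
(`eq_one_of_scale_eq`). The same kernel computation makes C injective, so det M ≠ 0.

Finally c = ±1 is Gauss's lemma over the ring of all algebraic integers
(`constant_eq_one_or_eq_neg_one`), and a rational equation of S_C comes from density of the rational
points in parameter space (`exists_rational_multiple`). -/

namespace HornKapranov

open MvPolynomial

/-! ### Derivations of the rational function field -/

/-- The function field `ℂ(u)`. -/
abbrev FunField (m : ℕ) : Type := FractionRing (MvPolynomial (Fin m) ℂ)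

/-- The coordinate `u_k` in the function field. -/
noncomputable def coord {m : ℕ} (k : Fin m) : FunField m :=
  algebraMap (MvPolynomial (Fin m) ℂ) (FunField m) (X k)

theorem aeval_coord {m : ℕ} (f : MvPolynomial (Fin m) ℂ) :
    aeval coord f = algebraMap _ (FunField m) f := by
  have : (aeval coord : MvPolynomial (Fin m) ℂ →ₐ[ℂ] FunField m) =
      IsScalarTower.toAlgHom ℂ _ (FunField m) := by
    ext k; simp [coord]
  exact DFunLike.congr_fun this f

/-- A derivation is the ε-part of an algebra map to the dual numbers. The map u_k ↦ u_k + ε h_k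
extends to fractions, because a dual number is a unit as soon as its first component is nonzero. -/
theorem exists_derivation_coord {m : ℕ} (h : Fin m → FunField m) :
    ∃ D : Derivation ℂ (FunField m) (FunField m), ∀ k, D (coord k) = h k := by
  let φ : MvPolynomial (Fin m) ℂ →ₐ[ℂ] DualNumber (FunField m) :=
    aeval fun k => TrivSqZeroExt.inl (coord k) + TrivSqZeroExt.inr (h k)
  have hφ : ∀ f, (φ f).fst = algebraMap _ (FunField m) f := by
    intro f
    have : ((TrivSqZeroExt.fstHom ℂ (FunField m) (FunField m)).comp φ) = aeval coord := by
      ext k; simp [φ]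
    rw [← aeval_coord, ← this]; rfl
  have hu : ∀ y : nonZeroDivisors (MvPolynomial (Fin m) ℂ), IsUnit (φ y) := by
    intro y
    rw [TrivSqZeroExt.isUnit_iff_isUnit_fst, hφ, isUnit_iff_ne_zero]
    exact IsLocalization.to_map_ne_zero_of_mem_nonZeroDivisors _ le_rfl y.2
  let Φ : FunField m →ₐ[ℂ] DualNumber (FunField m) := IsLocalization.liftAlgHom (f := φ) hu
  have hΦ : ∀ f, Φ (algebraMap _ _ f) = φ f := fun f => by simp [Φ]
  have hfst : ∀ x, (Φ x).fst = x := by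
    have : ((TrivSqZeroExt.fstHom ℂ (FunField m) (FunField m)).comp Φ) = AlgHom.id ℂ _ := by
      apply AlgHom.coe_ringHom_injective
      apply IsLocalization.ringHom_ext (nonZeroDivisors (MvPolynomial (Fin m) ℂ))
      ext x
      · simp only [RingHom.comp_apply, RingHom.coe_coe, AlgHom.comp_apply, hΦ,
          TrivSqZeroExt.fstHom_apply, hφ, AlgHom.id_apply]
      · simp [hΦ, hφ]
    intro x
    exact DFunLike.congr_fun this x
  refine ⟨Derivation.mk' ((TrivSqZeroExt.sndHom (FunField m) (FunField m)).restrictScalars ℂ ∘ₗ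
    Φ.toLinearMap) ?_, ?_⟩
  · intro a b
    simp [hfst, mul_comm]
  · intro k
    show (Φ (coord k)).snd = h k
    rw [coord, hΦ]
    simp [φ]

theorem derivation_aeval {m : ℕ} {K : Type*} [Field K] [Algebra ℂ K] (D : Derivation ℂ K K)
    (y : Fin m → K) (f : MvPolynomial (Fin m) ℂ) :
    D (aeval y f) = ∑ k, aeval y (pderiv k f) * D (y k) := by
  induction f using MvPolynomial.induction_on with
  | C a => simp
  | add p q hp hq => simp [hp, hq, add_mul, Finset.sum_add_distrib]
  | mul_X p j hp =>
    simp only [map_mul, aeval_X, Derivation.leibniz, hp, smul_eq_mul, map_add, pderiv_X]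
    simp only [add_mul, Finset.sum_add_distrib, Finset.mul_sum]
    congr 1
    · rw [Finset.sum_eq_single j]
      · simp
      · intro b _ hb; simp [Pi.single_eq_of_ne hb.symm]
      · simp
    · exact Finset.sum_congr rfl fun k _ => by ring

/-- Apply D to the minimal polynomial relation μ(x) = 0: this gives μ'(x)·D x = 0, and μ'(x) ≠ 0 by
separability in characteristic zero. -/
theorem derivation_eq_zero_of_isAlgebraic {k K : Type*} [Field k] [Field K] [Algebra k K]
    [CharZero k] (F : IntermediateField k K) (D : Derivation k K K) (hF : ∀ x ∈ F, D x = 0)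
    (x : K) (hx : IsAlgebraic F x) : D x = 0 := by
  let D' : Derivation F K K := Derivation.mk'
    { toFun := D, map_add' := map_add D, map_smul' := fun a b => by
        simp only [IntermediateField.smul_def, smul_eq_mul, Derivation.leibniz, hF _ a.2]
        simp } (fun a b => by simp)
  have hD' : ∀ y, D' y = D y := fun _ => rfl
  have hint := hx.isIntegral
  have h1 : D' (Polynomial.aeval x (minpoly F x)) = 0 := by simp
  rw [Derivation.map_aeval] at h1
  have h2 := (minpoly.irreducible hint).separable.aeval_derivative_ne_zero (minpoly.aeval F x)
  rw [← hD']
  simpa [h2] using h1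

theorem derivation_eq_zero_of_adjoin {k K : Type*} [Field k] [Field K] [Algebra k K]
    (s : Set K) (D : Derivation k K K) (hs : ∀ x ∈ s, D x = 0) :
    ∀ x ∈ IntermediateField.adjoin k s, D x = 0 := by
  intro x hx
  induction hx using IntermediateField.adjoin_induction with
  | mem x h => exact hs x h
  | algebraMap x => simp
  | add x y _ _ hx hy => simp [hx, hy]
  | inv x _ hx => simp [Derivation.leibniz_inv, hx]
  | mul x y _ _ hx hy => simp [hx, hy]

/-! ### The parametrization at points over extension fields, and the ideal of S_C -/

section

variable {n m : ℕ} {K : Type} [Field K] [Algebra ℂ K]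

/-- The linear form `l_i` over an extension field of `ℂ`. -/
def lin (C : Matrix (Fin n) (Fin m) ℤ) (i : Fin n) (v : Fin m → K) : K :=
  ∑ k, (C i k : K) * v k

/-- The parametrization `ψ_C` over an extension field of `ℂ`. -/
noncomputable def psiAt (C : Matrix (Fin n) (Fin m) ℤ) (v : Fin m → K) : Fin m → K :=
  fun k => ∏ i, lin C i v ^ C i k

/-- The linear form `l_i` as a polynomial. -/
noncomputable def linPoly (C : Matrix (Fin n) (Fin m) ℤ) (i : Fin n) : MvPolynomial (Fin m) ℂ :=
  ∑ k, (C i k : MvPolynomial (Fin m) ℂ) * X k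

theorem aeval_linPoly (C : Matrix (Fin n) (Fin m) ℤ) (i : Fin n) (v : Fin m → K) :
    aeval v (linPoly C i) = lin C i v := by
  simp [linPoly, lin]

theorem linPoly_ne_zero {C : Matrix (Fin n) (Fin m) ℤ} {i : Fin n} (h : C i ≠ 0) :
    linPoly C i ≠ 0 := by
  classical
  intro h0
  apply h
  funext k
  have := congrArg (fun p => aeval (Pi.single k (1 : ℂ)) p) h0
  simp only [aeval_linPoly, lin, map_zero] at this
  simpa [Pi.single_apply] using this

theorem lin_coord_ne_zero {C : Matrix (Fin n) (Fin m) ℤ} {i : Fin n} (h : C i ≠ 0) :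
    lin C i (coord : Fin m → FunField m) ≠ 0 := by
  rw [← aeval_linPoly, aeval_coord]
  simpa using linPoly_ne_zero h

theorem psiAt_ne_zero {K : Type} [Field K] {C : Matrix (Fin n) (Fin m) ℤ} {v : Fin m → K}
    (h : ∀ i, lin C i v ≠ 0) (k : Fin m) : psiAt C v k ≠ 0 :=
  Finset.prod_ne_zero_iff.mpr fun i _ => zpow_ne_zero _ (h i)

/-- Clears the denominators of f ∘ ψ_C uniformly in the field, so that complex points and the
generic point share the same numerator. -/
theorem exists_numerator (C : Matrix (Fin n) (Fin m) ℤ) (f : MvPolynomial (Fin m) ℂ) :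
    ∃ (N : ℕ) (F : MvPolynomial (Fin m) ℂ), ∀ (K : Type) [Field K] [Algebra ℂ K] (v : Fin m → K),
      (∀ i, lin C i v ≠ 0) → aeval v F = aeval (psiAt C v) f * (∏ i, lin C i v) ^ N := by
  induction f using MvPolynomial.induction_on with
  | C a => exact ⟨0, MvPolynomial.C a, by intros; simp⟩
  | add p q hp hq =>
    obtain ⟨N, F, hF⟩ := hp
    obtain ⟨N', F', hF'⟩ := hq
    refine ⟨N + N', F * (∏ i, linPoly C i) ^ N' + F' * (∏ i, linPoly C i) ^ N, ?_⟩
    intro K _ _ v hv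
    simp only [map_add, map_mul, map_pow, map_prod, aeval_linPoly, hF K v hv, hF' K v hv]
    ring
  | mul_X p k hp =>
    obtain ⟨N, F, hF⟩ := hp
    -- A common bound for the k-th column makes every shifted exponent `C i k + N'` nonnegative.
    obtain ⟨N', hN'⟩ : ∃ N' : ℕ, ∀ i, (C i k).natAbs ≤ N' :=
      ⟨∑ i, (C i k).natAbs, fun i => Finset.single_le_sum (f := fun i => (C i k).natAbs)
        (fun _ _ => Nat.zero_le _) (Finset.mem_univ i)⟩
    refine ⟨N + N', F * ∏ i, linPoly C i ^ (C i k + N').toNat, ?_⟩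
    intro K _ _ v hv
    have h : ∏ i, lin C i v ^ (C i k + N').toNat = psiAt C v k * (∏ i, lin C i v) ^ N' := by
      rw [psiAt, ← Finset.prod_pow, ← Finset.prod_mul_distrib]
      refine Finset.prod_congr rfl fun i _ => ?_
      have := hN' i
      have h0 : 0 ≤ C i k + N' := by omega
      rw [← zpow_natCast, ← zpow_natCast, Int.toNat_of_nonneg h0, zpow_add₀ (hv i)]
    simp only [map_mul, map_pow, map_prod, aeval_linPoly, hF K v hv, aeval_X, h]
    ring

/-- Here `s` is any Zariski dense set of parameters. It is taken to be all of ℂ^m to find the ideal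
of S_C, and ℚ^m to descend its equation to ℚ. -/
theorem aeval_psiAt_coord_eq_zero_iff {C : Matrix (Fin n) (Fin m) ℤ} (hrow : ∀ i, C i ≠ 0)
    (f : MvPolynomial (Fin m) ℂ) (s : Set (Fin m → ℂ))
    (hs : ∀ F : MvPolynomial (Fin m) ℂ, (∀ u ∈ s, aeval u F = 0) → F = 0) :
    aeval (psiAt C (coord : Fin m → FunField m)) f = 0 ↔
      ∀ u ∈ s, (∀ i, lin C i u ≠ 0) → aeval (psiAt C u) f = 0 := by
  obtain ⟨N, F, hF⟩ := exists_numerator C f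
  have hK := hF (FunField m) coord fun i => lin_coord_ne_zero (hrow i)
  have hne : (∏ i, lin C i (coord : Fin m → FunField m)) ^ N ≠ 0 :=
    pow_ne_zero _ (Finset.prod_ne_zero_iff.mpr fun i _ => lin_coord_ne_zero (hrow i))
  rw [aeval_coord] at hK
  constructor
  · intro h u _ hu
    rw [h, zero_mul] at hK
    have hF0 : F = 0 := by simpa using hK
    have := hF ℂ u hu
    rw [hF0, map_zero] at this
    exact (mul_eq_zero.mp this.symm).resolve_right
      (pow_ne_zero _ (Finset.prod_ne_zero_iff.mpr fun i _ => hu i))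
  · intro h
    -- The extra factor takes care of the points of `s` on the hyperplanes l_i = 0, where nothing is
    -- known about F.
    have hF0 : F * ∏ i, linPoly C i = 0 := by
      apply hs
      intro u hus
      by_cases hu : ∀ i, lin C i u ≠ 0
      · rw [map_mul, hF ℂ u hu, h u hus hu]; simp
      · push Not at hu
        obtain ⟨i, hi⟩ := hu
        rw [map_mul, map_prod, Finset.prod_eq_zero (Finset.mem_univ i), mul_zero]
        rw [aeval_linPoly, hi]
    have hF1 := (mul_eq_zero.mp hF0).resolve_right
      (Finset.prod_ne_zero_iff.mpr fun i _ => linPoly_ne_zero (hrow i))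
    rw [hF1, map_zero] at hK
    exact (mul_eq_zero.mp hK.symm).resolve_right hne

/-- The pullback `ψ_C^* : ℂ[y] → ℂ(u)`. -/
noncomputable def pullback (C : Matrix (Fin n) (Fin m) ℤ) :
    MvPolynomial (Fin m) ℂ →ₐ[ℂ] FunField m :=
  aeval (psiAt C coord)

theorem vanishingIdeal_psiImage (C : Matrix (Fin n) (Fin m) ℤ) :
    vanishingIdeal ℂ (psiImage C) = vanishingIdeal ℂ (S C) :=
  le_antisymm (fun _ hf _ hy => hy _ hf) fun _ hf y hy => hf y fun _ hp => hp y hy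

theorem vanishingIdeal_S {C : Matrix (Fin n) (Fin m) ℤ} (hrow : ∀ i, C i ≠ 0) :
    vanishingIdeal ℂ (S C) = RingHom.ker (pullback C) := by
  rw [← vanishingIdeal_psiImage]
  ext f
  rw [RingHom.mem_ker, pullback, aeval_psiAt_coord_eq_zero_iff hrow f Set.univ]
  · constructor
    · intro h u _ hu
      exact h _ ⟨u, hu, rfl⟩
    · rintro h _ ⟨u, hu, rfl⟩
      exact h u trivial hu
  · intro F hF
    apply MvPolynomial.funext
    intro u
    simpa [aeval_eq_eval] using hF u trivial

theorem exists_irreducible_ker_eq_span {C : Matrix (Fin n) (Fin m) ℤ} (hrow : ∀ i, C i ≠ 0)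
    (hnd : NonDefective C) :
    ∃ Δ : MvPolynomial (Fin m) ℂ, Irreducible Δ ∧ RingHom.ker (pullback C) = Ideal.span {Δ} := by
  rw [NonDefective, vanishingIdeal_S hrow] at hnd
  have hp : (RingHom.ker (pullback C)).IsPrime := RingHom.ker_isPrime _
  obtain ⟨Δ, hΔ, hprime⟩ := hp.exists_mem_prime_of_ne_bot (Ideal.ne_bot_of_height_eq_one hnd)
  exact ⟨Δ, hprime.irreducible, Ideal.eq_span_singleton_of_height_eq_one hnd hΔ hprime⟩

/-- Nullstellensatz: the ideal generated by an irreducible polynomial is prime, so it is the full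
vanishing ideal of its zero set. -/
theorem ker_eq_span_of_isDiscriminant {C : Matrix (Fin n) (Fin m) ℤ} (hrow : ∀ i, C i ≠ 0)
    {Δ : MvPolynomial (Fin m) ℤ} (h : IsDiscriminant C Δ) :
    RingHom.ker (pullback C) = Ideal.span {toComplex Δ} := by
  rw [← vanishingIdeal_S hrow, ← h.2.1]
  have hp : (Ideal.span {toComplex Δ}).IsPrime :=
    (Ideal.span_singleton_prime h.1.ne_zero).mpr h.1.prime
  rw [← IsPrime.vanishingIdeal_zeroLocus (K := ℂ) (Ideal.span {toComplex Δ})]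
  congr 1
  ext y
  simp only [Set.mem_ofPred_eq, mem_zeroLocus_iff, Ideal.mem_span_singleton]
  constructor
  · rintro h p ⟨q, rfl⟩
    rw [map_mul, aeval_eq_eval, h, zero_mul]
  · intro h
    simpa [aeval_eq_eval] using h _ dvd_rfl

/-! ### Logarithmic derivatives of ψ_C and derivations constant on its fibres -/

theorem derivation_prod_zpow {ι : Type*} (D : Derivation ℂ K K) (s : Finset ι)
    (x : ι → K) (e : ι → ℤ) (hx : ∀ i ∈ s, x i ≠ 0) :
    D (∏ i ∈ s, x i ^ e i) = (∏ i ∈ s, x i ^ e i) * ∑ i ∈ s, e i * (D (x i) / x i) := by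
  classical
  induction s using Finset.induction_on with
  | empty => simp
  | insert a s ha ih =>
    have hxa := hx a (Finset.mem_insert_self _ _)
    rw [Finset.prod_insert ha, Finset.sum_insert ha, Derivation.leibniz,
      ih fun i hi => hx i (Finset.mem_insert_of_mem hi), Derivation.leibniz_zpow]
    simp only [smul_eq_mul, zsmul_eq_mul, zpow_sub_one₀ hxa]
    field_simp
    ring

theorem derivation_lin (D : Derivation ℂ K K) (C : Matrix (Fin n) (Fin m) ℤ) (i : Fin n)
    (v : Fin m → K) : D (lin C i v) = lin C i fun k => D (v k) := by
  simp [lin, Derivation.leibniz]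

theorem derivation_psiAt (D : Derivation ℂ K K) {C : Matrix (Fin n) (Fin m) ℤ}
    {v : Fin m → K} (hv : ∀ i, lin C i v ≠ 0) (k : Fin m) :
    D (psiAt C v k) =
      psiAt C v k * ∑ i, C i k * (lin C i (fun j => D (v j)) / lin C i v) := by
  simp only [← derivation_lin]
  exact derivation_prod_zpow D _ _ _ fun i _ => hv i

/-- Euler's relation: regularity makes every coordinate of ψ_C homogeneous of degree 0. -/
theorem derivation_psiAt_of_eq {C : Matrix (Fin n) (Fin m) ℤ} (hreg : IsRegular C)
    (D : Derivation ℂ K K) {v : Fin m → K} (hD : ∀ k, D (v k) = v k)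
    (hv : ∀ i, lin C i v ≠ 0) (k : Fin m) : D (psiAt C v k) = 0 := by
  simp only [derivation_psiAt D hv, hD]
  have : ∑ i, (C i k : K) * (lin C i v / lin C i v) = ((∑ i, C i k : ℤ) : K) := by
    push_cast
    exact Finset.sum_congr rfl fun i _ => by rw [div_self (hv i), mul_one]
  have h2 := hreg k
  rw [show (∑ i, (C i k : K) * (lin C i (fun j => v j) / lin C i v)) = 0 by
    rw [this, h2, Int.cast_zero], mul_zero]

theorem exists_degreeOf_pos {f : MvPolynomial (Fin m) ℂ} (hf : Irreducible f) :
    ∃ k, 0 < degreeOf k f := by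
  by_contra! h
  apply hf.not_isUnit
  rw [isUnit_iff_totalDegree_of_isReduced]
  have h0 : f.totalDegree = 0 := by
    rw [totalDegree_eq_zero_iff]
    intro s hs k
    have := monomial_le_degreeOf k hs
    have := h k
    omega
  refine ⟨?_, h0⟩
  rw [isUnit_iff_ne_zero]
  intro hc
  have := totalDegree_eq_zero_iff_eq_C.mp h0
  rw [hc, map_zero] at this
  exact hf.ne_zero this

/-- A relation among the other coordinates would be a multiple of Δ not involving y_{k₀}, which is
impossible since degrees in y_{k₀} add under multiplication. -/
theorem algebraicIndependent_psiAt {C : Matrix (Fin n) (Fin m) ℤ} {Δ : MvPolynomial (Fin m) ℂ}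
    (hker : RingHom.ker (pullback C) = Ideal.span {Δ}) {k₀ : Fin m} (hk : 0 < degreeOf k₀ Δ) :
    AlgebraicIndependent ℂ fun k : {k // k ≠ k₀} => psiAt C (coord : Fin m → FunField m) k := by
  rw [algebraicIndependent_iff]
  intro p hp
  have h1 : rename (fun k : {k // k ≠ k₀} => (k : Fin m)) p ∈ RingHom.ker (pullback C) := by
    rw [RingHom.mem_ker, pullback, aeval_rename]
    exact hp
  rw [hker, Ideal.mem_span_singleton] at h1
  obtain ⟨q, hq⟩ := h1
  by_contra hp0
  have hinj : Function.Injective (fun k : {k // k ≠ k₀} => (k : Fin m)) := Subtype.val_injective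
  have hr : rename (fun k : {k // k ≠ k₀} => (k : Fin m)) p ≠ 0 := by
    rwa [Ne, ← map_zero (rename fun k : {k // k ≠ k₀} => (k : Fin m)),
      (rename_injective _ hinj).eq_iff]
  have hdeg : degreeOf k₀ (rename (fun k : {k // k ≠ k₀} => (k : Fin m)) p) = 0 := by
    classical
    by_contra h
    have hv : k₀ ∈ (rename (fun k : {k // k ≠ k₀} => (k : Fin m)) p).vars := by
      rw [vars_def, Multiset.mem_toFinset, ← Multiset.count_pos, ← degreeOf_def]
      omega
    have := vars_rename _ p hv
    simp at this
  have hΔ0 : Δ ≠ 0 := by rintro rfl; simp at hk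
  have hq0 : q ≠ 0 := by rintro rfl; simp at hq; exact hr (by simpa using hq)
  rw [hq, degreeOf_mul_eq hΔ0 hq0] at hdeg
  omega

theorem isTranscendenceBasis_coord :
    IsTranscendenceBasis ℂ (coord : Fin m → FunField m) :=
  have : Algebra.IsAlgebraic (MvPolynomial (Fin m) ℂ) (FunField m) :=
    IsLocalization.isAlgebraic _ (nonZeroDivisors _)
  (IsTranscendenceBasis.mvPolynomial (Fin m) ℂ).algebraMap_comp

theorem isAlgebraic_adjoin_mono {k L : Type*} [Field k] [Field L] [Algebra k L] {s t : Set L}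
    (hst : s ⊆ t) (hs : Algebra.IsAlgebraic (Algebra.adjoin k s) L) :
    Algebra.IsAlgebraic (Algebra.adjoin k t) L := by
  have hle := (Algebra.adjoin_mono (R := k) hst)
  refine ⟨fun x => ?_⟩
  obtain ⟨p, hp, hx⟩ := hs.isAlgebraic x
  refine ⟨p.map (Subalgebra.inclusion hle).toRingHom, ?_, ?_⟩
  · exact (Polynomial.map_ne_zero_iff (Subalgebra.inclusion_injective hle)).mpr hp
  · rw [Polynomial.aeval_def, Polynomial.eval₂_map]
    exact hx

/-- A transcendence basis between the range of `x` and its union with the range of `c` has exactly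
one more element than `x`, and that element comes from `c`. -/
theorem exists_isTranscendenceBasis_extending {k L ι κ : Type} [Field k] [Field L] [Algebra k L]
    [Finite ι] [Finite κ] {c : κ → L} (hc : IsTranscendenceBasis k c)
    {x : ι → L} (hx : AlgebraicIndependent k x) (hcard : Nat.card ι + 1 = Nat.card κ) :
    ∃ (B : Set L) (j : κ), IsTranscendenceBasis k ((↑) : B → L) ∧
      B ⊆ insert (c j) (Set.range x) := by
  have := isAlgebraic_adjoin_mono (Set.subset_union_right (s := Set.range x)) hc.isAlgebraic
  obtain ⟨B, hsB, hBt, hB⟩ := exists_isTranscendenceBasis_between (R := k) (Set.range x)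
    (Set.range x ∪ Set.range c) Set.subset_union_left
    ((algebraicIndependent_subtype_range hx.injective).mpr hx)
  have hBc : Cardinal.mk B = Cardinal.mk κ := hB.cardinalMk_eq hc
  have hBfin : B.Finite := by
    rw [← Cardinal.lt_aleph0_iff_set_finite, hBc]
    exact Cardinal.mk_lt_aleph0
  have hBcard : B.ncard = Nat.card κ := by
    rw [← Nat.card_coe_set_eq]
    exact congrArg Cardinal.toNat hBc
  have hxcard : (Set.range x).ncard = Nat.card ι := by
    rw [← Nat.card_coe_set_eq, Nat.card_range_of_injective hx.injective]
  have hdiff : (B \ Set.range x).ncard = 1 := by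
    have := Set.ncard_sdiff_add_ncard_of_subset hsB hBfin
    omega
  obtain ⟨b, hb⟩ := Set.ncard_eq_one.mp hdiff
  have hbB : b ∈ B \ Set.range x := by rw [hb]; rfl
  obtain ⟨j, rfl⟩ : b ∈ Set.range c := (hBt hbB.1).resolve_left hbB.2
  refine ⟨B, j, hB, fun y hy => ?_⟩
  by_cases hyx : y ∈ Set.range x
  · exact Or.inr hyx
  · have : y ∈ B \ Set.range x := ⟨hy, hyx⟩
    rw [hb] at this
    exact Or.inl this

theorem exists_coord_extending {C : Matrix (Fin n) (Fin m) ℤ} {Δ : MvPolynomial (Fin m) ℂ}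
    (hΔ : Irreducible Δ) (hker : RingHom.ker (pullback C) = Ideal.span {Δ}) :
    ∃ (B : Set (FunField m)) (j : Fin m),
      IsTranscendenceBasis ℂ ((↑) : B → FunField m) ∧
      B ⊆ insert (coord j) (Set.range (psiAt C (coord : Fin m → FunField m))) := by
  obtain ⟨k₀, hk⟩ := exists_degreeOf_pos hΔ
  obtain ⟨B, j, hB, hsub⟩ := exists_isTranscendenceBasis_extending isTranscendenceBasis_coord
    (algebraicIndependent_psiAt hker hk) (by
      have := k₀.pos
      simp only [ne_eq, Nat.card_eq_fintype_card, Fintype.card_subtype_compl, Fintype.card_fin,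
        Fintype.card_unique]
      omega)
  refine ⟨B, j, hB, hsub.trans (Set.insert_subset_insert ?_)⟩
  rintro _ ⟨k, rfl⟩
  exact ⟨k, rfl⟩

/-- ℂ(u) has transcendence degree one over the field generated by ψ_C(u), so the derivations killing
ψ_C form a line, spanned by the Euler derivation E. -/
theorem exists_derivation_parallel {C : Matrix (Fin n) (Fin m) ℤ} (hrow : ∀ i, C i ≠ 0)
    (hreg : IsRegular C) {Δ : MvPolynomial (Fin m) ℂ}
    (hΔ : Irreducible Δ) (hker : RingHom.ker (pullback C) = Ideal.span {Δ}) :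
    ∃ j : Fin m, ∀ D : Derivation ℂ (FunField m) (FunField m),
      (∀ k, D (psiAt C coord k) = 0) → ∀ k, coord j * D (coord k) = D (coord j) * coord k := by
  obtain ⟨B, j, hB, hBsub⟩ := exists_coord_extending hΔ hker
  refine ⟨j, fun D hD k => ?_⟩
  obtain ⟨E, hE⟩ := exists_derivation_coord (coord : Fin m → FunField m)
  have hEψ := derivation_psiAt_of_eq hreg E hE fun i => lin_coord_ne_zero (hrow i)
  -- This combination kills u_j by its choice of coefficients and kills ψ_C because D and E both do.
  have hzero : ∀ x ∈ B, (coord j • D - D (coord j) • E) x = 0 := by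
    intro x hx
    rcases hBsub hx with rfl | ⟨k, rfl⟩
    · simp [hE, mul_comm]
    · simp [hD, hEψ]
  have halg := hB.isAlgebraic_field
  rw [Subtype.range_coe] at halg
  have := derivation_eq_zero_of_isAlgebraic _ _ (derivation_eq_zero_of_adjoin B _ hzero)
    (coord k) (halg.isAlgebraic _)
  simp only [Derivation.coe_sub, Derivation.coe_smul, Pi.sub_apply, Pi.smul_apply, smul_eq_mul,
    hE] at this
  exact sub_eq_zero.mp this

end

variable {n m : ℕ}

theorem coord_ne_zero (k : Fin m) : (coord k : FunField m) ≠ 0 := by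
  simp [coord]

/-- If Cv = 0, the constant vector field v kills every l_i, hence ψ_C, and must be parallel to the
Euler field u. For v ≠ 0 this forces m = 1, and then C = 0. -/
theorem mulVec_injective_of_ker_eq_span (hmn : m ≤ n) {C : Matrix (Fin n) (Fin m) ℤ}
    (hrow : ∀ i, C i ≠ 0) (hreg : IsRegular C) {Δ : MvPolynomial (Fin m) ℂ}
    (hΔ : Irreducible Δ) (hker : RingHom.ker (pullback C) = Ideal.span {Δ})
    {v : Fin m → ℤ} (hv : C.mulVec v = 0) : v = 0 := by
  by_contra hv0
  obtain ⟨j, hj⟩ := exists_derivation_parallel hrow hreg hΔ hker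
  obtain ⟨D, hD⟩ := exists_derivation_coord fun k => (v k : FunField m)
  have hlin : ∀ i, lin C i (fun k => (v k : FunField m)) = 0 := by
    intro i
    have := congrArg (Int.cast (R := FunField m)) (congrFun hv i)
    simpa [Matrix.mulVec, dotProduct, lin] using this
  have hpar := hj D fun k => by
    rw [derivation_psiAt D (fun i => lin_coord_ne_zero (hrow i))]
    simp [hD, hlin]
  simp only [hD] at hpar
  have hvj : v j ≠ 0 := by
    intro h
    apply hv0
    funext k
    have := hpar k
    simpa [h, coord_ne_zero] using this
  have hall : ∀ k, k = j := by
    intro k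
    by_contra hkj
    have h1 : (X j * MvPolynomial.C (v k : ℂ) : MvPolynomial (Fin m) ℂ) =
        MvPolynomial.C (v j : ℂ) * X k := by
      apply IsFractionRing.injective (MvPolynomial (Fin m) ℂ) (FunField m)
      have h2 := hpar k
      simp only [coord] at h2
      simpa using h2
    have h2 := congrArg (eval (Pi.single k (1 : ℂ))) h1
    simp [Pi.single_eq_of_ne (Ne.symm hkj)] at h2
    exact hvj (Int.cast_eq_zero.mp h2.symm)
  -- With m = 1 a row must exist for the contradiction: it is zero because its only entry times v_j
  -- ≠ 0 vanishes.
  have hn : 0 < n := j.pos.trans_le hmn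
  apply hrow ⟨0, hn⟩
  funext k
  have h3 := congrFun hv ⟨0, hn⟩
  rw [Matrix.mulVec, dotProduct, Finset.sum_eq_single j
    (fun b _ hb => absurd (hall b) hb) (by simp)] at h3
  rw [hall k]
  exact (mul_eq_zero.mp h3).resolve_right hvj

/-! ### The logarithmic Gauss map -/

theorem exists_not_dvd_pderiv {Δ : MvPolynomial (Fin m) ℂ} (hΔ : Irreducible Δ) :
    ∃ k, ¬ Δ ∣ pderiv k Δ := by
  obtain ⟨k, hk⟩ := exists_degreeOf_pos hΔ
  refine ⟨k, ?_⟩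
  rintro ⟨q, hq⟩
  have hlt : degreeOf k (pderiv k Δ) < degreeOf k Δ := by
    rw [degreeOf_lt_iff hk]
    intro s hs
    rw [mem_support_iff, coeff_pderiv] at hs
    have := monomial_le_degreeOf k (mem_support_iff.mpr (left_ne_zero_of_mul hs))
    simp at this
    omega
  have hne : pderiv k Δ ≠ 0 := by
    intro h0
    have : degreeOf k Δ ≤ 0 := by
      rw [degreeOf_le_iff]
      intro s hs
      by_contra hsk
      have h1 := congrArg (coeff (s - Finsupp.single k 1)) h0
      rw [coeff_pderiv, coeff_zero, tsub_add_cancel_of_le (by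
        rw [Finsupp.single_le_iff]; omega)] at h1
      rw [mem_support_iff] at hs
      rcases mul_eq_zero.mp h1 with h2 | h2
      · exact hs h2
      · exact Nat.cast_add_one_ne_zero _ h2
    omega
  have hq0 : q ≠ 0 := by rintro rfl; exact hne (by simpa using hq)
  rw [hq, degreeOf_mul_eq hΔ.ne_zero hq0] at hlt
  omega

/-- The logarithmic derivative `y_k ∂f/∂y_k`. -/
noncomputable def theta (k : Fin m) (f : MvPolynomial (Fin m) ℂ) : MvPolynomial (Fin m) ℂ :=
  X k * pderiv k f

/-- The logarithmic Jacobian ∂_a log ψ_k = ∑_i c_ik c_ia / l_i(u) is symmetric in a and k. The chain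
rule for Δ(ψ_C(u)) = 0 says that g = (θ_k Δ)(ψ_C(u)) is killed on one side; by symmetry the vector
field g kills ψ_C, so g is parallel to u. -/
theorem exists_pullback_theta_eq {C : Matrix (Fin n) (Fin m) ℤ} (hrow : ∀ i, C i ≠ 0)
    (hreg : IsRegular C) {Δ : MvPolynomial (Fin m) ℂ}
    (hΔ : Irreducible Δ) (hker : RingHom.ker (pullback C) = Ideal.span {Δ}) :
    ∃ c : FunField m, c ≠ 0 ∧ ∀ k, pullback C (theta k Δ) = c * coord k := by
  classical
  obtain ⟨j, hj⟩ := exists_derivation_parallel hrow hreg hΔ hker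
  set g : Fin m → FunField m := fun k => pullback C (theta k Δ) with hg
  have hl : ∀ i, lin C i (coord : Fin m → FunField m) ≠ 0 := fun i => lin_coord_ne_zero (hrow i)
  have hgk : ∀ k, g k = psiAt C coord k * aeval (psiAt C coord) (pderiv k Δ) := by
    intro k
    simp [hg, pullback, theta]
  have hΔ0 : aeval (psiAt C (coord : Fin m → FunField m)) Δ = 0 := by
    have : Δ ∈ RingHom.ker (pullback C) := by rw [hker]; exact Ideal.mem_span_singleton_self _
    exact this
  obtain ⟨D, hD⟩ := exists_derivation_coord g
  have hDψ : ∀ a, D (psiAt C coord a) = 0 := by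
    intro a
    obtain ⟨E, hE⟩ := exists_derivation_coord (Pi.single a (1 : FunField m))
    have h1 := derivation_aeval E (psiAt C coord) Δ
    rw [hΔ0, map_zero] at h1
    simp only [derivation_psiAt _ hl, hD]
    have h2 : ∀ i, lin C i (fun k => Pi.single a (1 : FunField m) k) = C i a := by
      intro i
      simp [lin, Pi.single_apply]
    -- The logarithmic derivative of ψ_a along g equals, by symmetry, the derivative of Δ ∘ ψ_C in
    -- the direction u_a, which is `h1`.
    have h3 : ∑ i, (C i a : FunField m) * (lin C i (fun k => g k) / lin C i coord) = 0 := by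
      rw [h1]
      simp only [derivation_psiAt _ hl, hE, h2]
      simp only [lin, Finset.sum_div, Finset.mul_sum]
      rw [Finset.sum_comm]
      refine Finset.sum_congr rfl fun k _ => Finset.sum_congr rfl fun i _ => ?_
      rw [hgk]
      ring
    rw [h3, mul_zero]
  have hpar := hj D hDψ
  simp only [hD] at hpar
  have hc : ∀ k, g k = g j / coord j * coord k := by
    intro k
    rw [div_mul_eq_mul_div, eq_div_iff (coord_ne_zero j), mul_comm, hpar]
  refine ⟨g j / coord j, ?_, hc⟩
  -- A zero factor would make every partial derivative of Δ vanish on S_C, hence be divisible by Δ.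
  intro h0
  obtain ⟨k, hk⟩ := exists_not_dvd_pderiv hΔ
  apply hk
  rw [← Ideal.mem_span_singleton, ← hker, RingHom.mem_ker]
  have h1 := hc k
  rw [h0, zero_mul, hgk] at h1
  exact (mul_eq_zero.mp h1).resolve_left (psiAt_ne_zero hl k)

/-! ### The torus action and the stabilizer of Δ -/

theorem scale_X (ε : Fin m → ℂˣ) (k : Fin m) :
    scale ε (X k) = MvPolynomial.C (ε k : ℂ) * X k :=
  aeval_X _ _

theorem scale_C (ε : Fin m → ℂˣ) (a : ℂ) :
    scale ε (MvPolynomial.C a) = MvPolynomial.C a :=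
  (scale ε).commutes a

theorem scale_scale (ε ε' : Fin m → ℂˣ) (f : MvPolynomial (Fin m) ℂ) :
    scale ε (scale ε' f) = scale (ε * ε') f := by
  have : (scale ε).comp (scale ε') = scale (ε * ε') := by
    apply MvPolynomial.algHom_ext
    intro j
    rw [AlgHom.comp_apply, scale_X, map_mul, scale_C, scale_X, scale_X, Pi.mul_apply,
      Units.val_mul, map_mul]
    ring
  exact DFunLike.congr_fun this f

theorem scale_one (f : MvPolynomial (Fin m) ℂ) : scale 1 f = f := by
  have : scale (1 : Fin m → ℂˣ) = AlgHom.id ℂ (MvPolynomial (Fin m) ℂ) := by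
    apply MvPolynomial.algHom_ext
    intro j
    simp [scale_X]
  exact DFunLike.congr_fun this f

theorem prod_zpow_const {ι K : Type*} [Field K] (s : Finset ι) (e : ι → ℤ) {b : K} (hb : b ≠ 0) :
    ∏ i ∈ s, b ^ e i = b ^ ∑ i ∈ s, e i := by
  classical
  induction s using Finset.induction_on with
  | empty => simp
  | insert a s ha ih => rw [Finset.prod_insert ha, Finset.sum_insert ha, ih, zpow_add₀ hb]

theorem theta_mul (k : Fin m) (f g : MvPolynomial (Fin m) ℂ) :
    theta k (f * g) = theta k f * g + f * theta k g := by
  simp only [theta, pderiv_mul]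
  ring

theorem theta_C (k : Fin m) (a : ℂ) : theta k (MvPolynomial.C a) = 0 := by
  rw [theta, pderiv_C, mul_zero]

theorem theta_X (k j : Fin m) : theta k (X j) = if j = k then X j else 0 := by
  split_ifs with h
  · rw [theta, h, pderiv_X_self, mul_one]
  · rw [theta, pderiv_X_of_ne h, mul_zero]

theorem scale_theta (ε : Fin m → ℂˣ) (k : Fin m) (f : MvPolynomial (Fin m) ℂ) :
    scale ε (theta k f) = theta k (scale ε f) := by
  induction f using MvPolynomial.induction_on with
  | C a => rw [scale_C, theta_C, map_zero]
  | add p q hp hq =>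
    have hadd : ∀ f g : MvPolynomial (Fin m) ℂ, theta k (f + g) = theta k f + theta k g :=
      fun f g => by simp only [theta, map_add, mul_add]
    rw [hadd, map_add, hp, hq, map_add, hadd]
  | mul_X p j hp =>
    have hj : scale ε (theta k (X j)) = theta k (scale ε (X j)) := by
      rw [scale_X, theta_mul, theta_C, zero_mul, zero_add, theta_X]
      split_ifs
      · rw [scale_X]
      · rw [map_zero, mul_zero]
    rw [theta_mul, map_add, map_mul, map_mul, map_mul, theta_mul, hp, hj]

/-- On S_C, y_k is the product of the T_i = ∑_k c_ik θ_k Δ to the powers c_ik, as T_i pulls back to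
b·l_i(u) and b cancels by regularity. Scaling by ε multiplies every T_i by c, which cancels too,
while y_k is multiplied by ε_k. -/
theorem eq_one_of_scale_eq {C : Matrix (Fin n) (Fin m) ℤ} (hrow : ∀ i, C i ≠ 0)
    (hreg : IsRegular C) {Δ : MvPolynomial (Fin m) ℂ}
    (hΔ : Irreducible Δ) (hker : RingHom.ker (pullback C) = Ideal.span {Δ})
    {ε : Fin m → ℂˣ} {c : ℂ} (hε : scale ε Δ = MvPolynomial.C c * Δ) : ε = 1 := by
  obtain ⟨b, hb, hbk⟩ := exists_pullback_theta_eq hrow hreg hΔ hker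
  have hl : ∀ i, lin C i (coord : Fin m → FunField m) ≠ 0 := fun i => lin_coord_ne_zero (hrow i)
  let T : Fin n → MvPolynomial (Fin m) ℂ := fun i => ∑ k, (C i k : MvPolynomial (Fin m) ℂ) * theta k Δ
  have hT : ∀ i, pullback C (T i) = b * lin C i coord := by
    intro i
    simp only [T, map_sum, map_mul, map_intCast, hbk, lin, Finset.mul_sum]
    exact Finset.sum_congr rfl fun k _ => by ring
  have hTs : ∀ i, scale ε (T i) = MvPolynomial.C c * T i := by
    intro i
    simp only [T, map_sum, map_mul, map_intCast, scale_theta, hε, Finset.mul_sum]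
    refine Finset.sum_congr rfl fun k _ => ?_
    simp only [theta, pderiv_C_mul]
    ring
  funext k
  let P : MvPolynomial (Fin m) ℂ := ∏ i, T i ^ (C i k).toNat
  let Q : MvPolynomial (Fin m) ℂ := ∏ i, T i ^ (-C i k).toNat
  have hPs : scale ε P = MvPolynomial.C c ^ (∑ i, (C i k).toNat) * P := by
    simp [P, hTs, mul_pow, Finset.prod_mul_distrib, Finset.prod_pow_eq_pow_sum]
  -- P and Q have the same degree in the T_i because the k-th column sums to 0.
  have hQs : scale ε Q = MvPolynomial.C c ^ (∑ i, (C i k).toNat) * Q := by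
    have hsum : ∑ i, (-C i k).toNat = ∑ i, (C i k).toNat := by
      zify
      have := hreg k
      rw [← sub_eq_zero, ← Finset.sum_sub_distrib, ← neg_eq_zero, ← Finset.sum_neg_distrib, ← this]
      exact Finset.sum_congr rfl fun i _ => by omega
    rw [← hsum]
    simp [Q, hTs, mul_pow, Finset.prod_mul_distrib, Finset.prod_pow_eq_pow_sum]
  have hP0 : pullback C P ≠ 0 := by
    simp only [P, map_prod, map_pow, hT]
    exact Finset.prod_ne_zero_iff.mpr fun i _ => pow_ne_zero _ (mul_ne_zero hb (hl i))
  have hψ : psiAt C coord k * pullback C Q = pullback C P := by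
    have h1 : psiAt C coord k = ∏ i, (b * lin C i coord) ^ C i k := by
      simp only [mul_zpow, Finset.prod_mul_distrib, psiAt]
      rw [prod_zpow_const _ _ hb, hreg k, zpow_zero, one_mul]
    simp only [h1, P, Q, map_prod, map_pow, hT]
    rw [← Finset.prod_mul_distrib]
    refine Finset.prod_congr rfl fun i _ => ?_
    rw [← zpow_natCast, ← zpow_natCast, ← zpow_add₀ (mul_ne_zero hb (hl i))]
    congr 1
    omega
  have hmem : X k * Q - P ∈ RingHom.ker (pullback C) := by
    rw [RingHom.mem_ker, map_sub, map_mul, ← hψ, pullback, aeval_X, sub_self]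
  rw [hker, Ideal.mem_span_singleton] at hmem
  obtain ⟨R, hR⟩ := hmem
  -- Scaling preserves the ideal (Δ), so ε_k y_k Q - P, up to a power of c, also vanishes on S_C;
  -- comparison with y_k Q - P gives ε_k = 1.
  have hmem2 : scale ε (X k * Q - P) ∈ RingHom.ker (pullback C) := by
    rw [hker, Ideal.mem_span_singleton, hR, map_mul, hε]
    exact ⟨MvPolynomial.C c * scale ε R, by ring⟩
  have hc : c ≠ 0 := by
    rintro rfl
    rw [map_zero, zero_mul] at hε
    have h1 : scale ε⁻¹ (scale ε Δ) = Δ := by rw [scale_scale, inv_mul_cancel, scale_one]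
    rw [hε, map_zero] at h1
    exact hΔ.ne_zero h1.symm
  rw [RingHom.mem_ker, map_sub, map_mul, hPs, hQs, scale_X] at hmem2
  have hC : ∀ a : ℂ, pullback C (MvPolynomial.C a) = algebraMap ℂ (FunField m) a :=
    fun a => (pullback C).commutes a
  have hXk : pullback C (X k) = psiAt C coord k := by simp [pullback]
  simp only [map_sub, map_mul, map_pow, hC, hXk] at hmem2
  have h2 : algebraMap ℂ (FunField m) c ^ (∑ i, (C i k).toNat) *
      ((algebraMap ℂ (FunField m) (ε k) - 1) * pullback C P) = 0 := by
    rw [← hmem2, ← hψ]; ring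
  have hc' : algebraMap ℂ (FunField m) c ≠ 0 := by simpa using hc
  have h3 := (mul_eq_zero.mp ((mul_eq_zero.mp h2).resolve_left (pow_ne_zero _ hc'))).resolve_right hP0
  have h4 : algebraMap ℂ (FunField m) (ε k) = algebraMap ℂ (FunField m) 1 := by
    rw [map_one]; exact sub_eq_zero.mp h3
  exact Units.ext ((algebraMap ℂ (FunField m)).injective h4)

/-! ### Duality between G_M and the lattice ℤM -/

theorem mem_columnLattice_iff {M : Matrix (Fin m) (Fin m) ℤ} {w : Fin m → ℤ} :
    w ∈ columnLattice M ↔ ∃ x, M.mulVec x = w := by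
  rw [columnLattice, ← Matrix.range_mulVecLin]
  rfl

theorem zpow_sum {ι A : Type*} [CommGroup A] (s : Finset ι) (e : ι → ℤ) (b : A) :
    b ^ ∑ i ∈ s, e i = ∏ i ∈ s, b ^ e i := by
  classical
  induction s using Finset.induction_on with
  | empty => simp
  | insert a s ha ih => rw [Finset.prod_insert ha, Finset.sum_insert ha, ← ih, zpow_add]

theorem prod_zpow_mulVec {A : Type*} [CommGroup A] (M : Matrix (Fin m) (Fin m) ℤ)
    (y : Fin m → A) (x : Fin m → ℤ) :
    ∏ i, y i ^ M.mulVec x i = ∏ k, (∏ i, y i ^ M i k) ^ x k := by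
  simp only [Matrix.mulVec, dotProduct, ← Finset.prod_zpow, ← zpow_mul]
  rw [Finset.prod_comm]
  refine Finset.prod_congr rfl fun i _ => ?_
  rw [zpow_sum]

theorem finite_G {M : Matrix (Fin m) (Fin m) ℤ} (hM : M.det ≠ 0) : Finite (G M) := by
  have hsub : (G M : Set (Fin m → ℂˣ)) ⊆
      Set.univ.pi fun _ => {x : ℂˣ | x ^ M.det.natAbs = 1} := by
    intro ε hε i _
    -- The vector M·adj(M)·e_i = det(M)·e_i lies in ℤM, so ε_i is a root of unity of order dividing
    -- |det M|.
    have h1 := prod_zpow_mulVec M ε (M.adjugate.mulVec (Pi.single i 1))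
    rw [Matrix.mulVec_mulVec, Matrix.mul_adjugate] at h1
    have hε' : ∀ k, ∏ i, ε i ^ M i k = 1 := fun k => congrFun hε k
    simp only [hε', one_zpow, Finset.prod_const_one, Matrix.smul_mulVec, Matrix.one_mulVec] at h1
    rw [Finset.prod_eq_single i] at h1
    · simp only [Pi.smul_apply, Pi.single_eq_same, smul_eq_mul, mul_one] at h1
      show ε i ^ M.det.natAbs = 1
      rcases Int.natAbs_eq M.det with h | h
      · rw [h, zpow_natCast] at h1; exact h1
      · rw [h, zpow_neg, inv_eq_one, zpow_natCast] at h1; exact h1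
    · intro b _ hb
      simp [Pi.single_eq_of_ne hb]
    · simp
  refine Set.Finite.to_subtype (Set.Finite.subset (Set.Finite.pi fun _ => ?_) hsub)
  have : NeZero M.det.natAbs := ⟨Int.natAbs_ne_zero.mpr hM⟩
  have hfin : Finite (rootsOfUnity M.det.natAbs ℂ) := inferInstance
  exact (Set.toFinite ((rootsOfUnity M.det.natAbs ℂ : Subgroup ℂˣ) : Set ℂˣ)).subset
    fun x hx => (mem_rootsOfUnity _ _).mpr hx

theorem mem_columnLattice_iff_forall_G {M : Matrix (Fin m) (Fin m) ℤ} (hM : M.det ≠ 0)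
    (w : Fin m → ℤ) :
    w ∈ columnLattice M ↔ ∀ ε ∈ G M, ∏ i, ε i ^ w i = 1 := by
  rw [mem_columnLattice_iff]
  constructor
  · rintro ⟨x, rfl⟩ ε hε
    have hε' : ∀ k, ∏ i, ε i ^ M i k = 1 := fun k => congrFun hε k
    simp [prod_zpow_mulVec, hε']
  · intro h
    set N : Matrix (Fin m) (Fin m) ℂ := M.map (Int.castRingHom ℂ) with hN
    have hdet : IsUnit N.det := by
      rw [hN, ← RingHom.mapMatrix_apply, ← RingHom.map_det, isUnit_iff_ne_zero]
      simpa using hM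
    have hexp : ∀ (z : Fin m → ℂ) (v : Fin m → ℤ),
        ((∏ i, (Units.mk0 (Complex.exp (z i)) (Complex.exp_ne_zero _)) ^ v i : ℂˣ) : ℂ) =
          Complex.exp (∑ i, v i * z i) := by
      intro z v
      rw [Units.coe_prod, Complex.exp_sum]
      refine Finset.prod_congr rfl fun i _ => ?_
      rw [Units.val_zpow_eq_zpow_val, Units.val_mk0, Complex.exp_int_mul]
    have hint : ∀ j, ∃ a : ℤ, ∑ i, N⁻¹ j i * w i = a := by
      intro j
      -- The exponential of 2πi times row j of M⁻¹ lies in G_M, since M⁻¹M is integral. Its value on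
      -- w is 1 exactly when (M⁻¹w)_j is an integer.
      have hε : (fun i => Units.mk0 (Complex.exp (2 * Real.pi * Complex.I * N⁻¹ j i))
          (Complex.exp_ne_zero _)) ∈ G M := by
        show alpha M _ = 1
        funext k
        apply Units.ext
        show ((∏ i, _ ^ M i k : ℂˣ) : ℂ) = 1
        rw [hexp (fun i => 2 * Real.pi * Complex.I * N⁻¹ j i) fun i => M i k]
        have h1 : ∑ i, (M i k : ℂ) * (2 * Real.pi * Complex.I * N⁻¹ j i) =
            2 * Real.pi * Complex.I * (N⁻¹ * N) j k := by
          rw [Matrix.mul_apply, Finset.mul_sum]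
          refine Finset.sum_congr rfl fun i _ => ?_
          simp only [hN, Matrix.map_apply, Int.coe_castRingHom]
          ring
        rw [h1, Matrix.nonsing_inv_mul _ hdet, Matrix.one_apply]
        split_ifs
        · rw [mul_one, Complex.exp_two_pi_mul_I]
        · simp
      have h2 := congrArg Units.val (h _ hε)
      rw [hexp (fun i => 2 * Real.pi * Complex.I * N⁻¹ j i), Units.val_one,
        Complex.exp_eq_one_iff] at h2
      obtain ⟨a, ha⟩ := h2
      refine ⟨a, mul_left_cancel₀ Complex.two_pi_I_ne_zero ?_⟩
      rw [mul_comm _ (a : ℂ), ← ha, Finset.mul_sum]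
      exact Finset.sum_congr rfl fun i _ => by ring
    choose a ha using hint
    refine ⟨a, ?_⟩
    have h3 : N.mulVec (fun j => (a j : ℂ)) = fun i => (w i : ℂ) := by
      have : (fun j => (a j : ℂ)) = N⁻¹.mulVec fun i => (w i : ℂ) := by
        funext j
        rw [← ha]
        rfl
      rw [this, Matrix.mulVec_mulVec, Matrix.mul_nonsing_inv _ hdet, Matrix.one_mulVec]
    funext i
    have h4 := congrFun h3 i
    simp only [Matrix.mulVec, dotProduct, hN, Matrix.map_apply, Int.coe_castRingHom] at h4 ⊢
    exact_mod_cast h4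

/-! ### Laurent polynomials: denominators, units, divisibility -/

theorem mono_add (v w : Fin m → ℤ) : mono (v + w) = mono v * mono w := by
  simp [mono, AddMonoidAlgebra.single_mul_single]

theorem mono_zero : (mono 0 : Laurent m) = 1 := rfl

theorem isUnit_mono (v : Fin m → ℤ) : IsUnit (mono v) :=
  IsUnit.of_mul_eq_one (mono (-v)) (by rw [← mono_add, add_neg_cancel, mono_zero])

/-- A vector of natural exponents as a vector of integers. -/
def castExp (s : Fin m →₀ ℕ) : Fin m → ℤ := fun i => s i

theorem castExp_injective : Function.Injective (castExp (m := m)) := by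
  intro s t h
  ext i
  have := congrFun h i
  simpa [castExp] using this

theorem toLaurent_monomial (s : Fin m →₀ ℕ) (a : ℂ) :
    toLaurent (monomial s a) = AddMonoidAlgebra.single (castExp s) a := by
  have h : ∏ i, (mono (Pi.single i 1) : Laurent m) ^ s i = mono (castExp s) := by
    simp only [mono, AddMonoidAlgebra.single_pow, AddMonoidAlgebra.prod_single, one_pow,
      Finset.prod_const_one]
    congr 1
    funext j
    simp [castExp, Finset.sum_apply, Pi.single_apply]
  rw [toLaurent, aeval_monomial, Finsupp.prod_fintype _ _ (fun i => pow_zero _), h, mono,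
    ← Algebra.smul_def, AddMonoidAlgebra.smul_single, smul_eq_mul, mul_one]

theorem coeff_toLaurent (f : MvPolynomial (Fin m) ℂ) (s : Fin m →₀ ℕ) :
    (toLaurent f).coeff (castExp s) = f.coeff s := by
  classical
  induction f using MvPolynomial.induction_on' with
  | monomial t a =>
    rw [toLaurent_monomial, AddMonoidAlgebra.coeff_single, Finsupp.single_apply, coeff_monomial]
    simp only [castExp_injective.eq_iff]
  | add p q hp hq => simp [hp, hq]

theorem coeff_toLaurent_of_notMem_range (f : MvPolynomial (Fin m) ℂ) {w : Fin m → ℤ}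
    (hw : w ∉ Set.range (castExp (m := m))) : (toLaurent f).coeff w = 0 := by
  classical
  induction f using MvPolynomial.induction_on' with
  | monomial t a =>
    rw [toLaurent_monomial, AddMonoidAlgebra.coeff_single, Finsupp.single_apply, if_neg]
    exact fun h => hw ⟨t, h⟩
  | add p q hp hq => simp [hp, hq]

theorem toLaurent_injective : Function.Injective (toLaurent (m := m)) := by
  intro f g h
  ext s
  rw [← coeff_toLaurent, ← coeff_toLaurent, h]

theorem toLaurent_monomial_add (s t : Fin m →₀ ℕ) :
    toLaurent (monomial (s + t) (1 : ℂ)) =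
      toLaurent (monomial s 1) * toLaurent (monomial t 1) := by
  rw [← map_mul, monomial_mul, one_mul]

theorem exists_toLaurent_eq_mul (h : Laurent m) :
    ∃ (s : Fin m →₀ ℕ) (f : MvPolynomial (Fin m) ℂ),
      toLaurent (monomial s 1) * h = toLaurent f := by
  induction h using AddMonoidAlgebra.induction_linear with
  | zero => exact ⟨0, 0, by simp⟩
  | add p q hp hq =>
    obtain ⟨s, f, hf⟩ := hp
    obtain ⟨t, g, hg⟩ := hq
    refine ⟨s + t, monomial t 1 * f + monomial s 1 * g, ?_⟩
    rw [map_add, map_mul, map_mul, ← hf, ← hg, toLaurent_monomial_add]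
    ring
  | single w a =>
    refine ⟨Finsupp.equivFunOnFinite.symm fun i => (-w i).toNat,
      monomial (Finsupp.equivFunOnFinite.symm fun i => (w i).toNat) a, ?_⟩
    rw [toLaurent_monomial, toLaurent_monomial, AddMonoidAlgebra.single_mul_single, one_mul]
    congr 1
    funext i
    simp only [castExp, Pi.add_apply, Finsupp.equivFunOnFinite_symm_apply_apply]
    omega

theorem isUnit_toLaurent_monomial (s : Fin m →₀ ℕ) : IsUnit (toLaurent (monomial s (1 : ℂ))) := by
  rw [toLaurent_monomial]
  exact isUnit_mono _

/-- After clearing denominators a unit becomes a polynomial divisor of a monomial, and such divisors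
are terms. -/
theorem exists_eq_single_of_isUnit {h : Laurent m} (hh : IsUnit h) :
    ∃ (v : Fin m → ℤ) (c : ℂ), c ≠ 0 ∧ h = AddMonoidAlgebra.single v c := by
  obtain ⟨h', hh'⟩ := hh.exists_right_inv
  obtain ⟨s, f, hf⟩ := exists_toLaurent_eq_mul h
  obtain ⟨t, g, hg⟩ := exists_toLaurent_eq_mul h'
  have hfg : f * g = monomial (s + t) 1 := by
    apply toLaurent_injective
    rw [map_mul, ← hf, ← hg, toLaurent_monomial_add]
    linear_combination (toLaurent (monomial s 1) * toLaurent (monomial t 1)) * hh'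
  obtain ⟨r, b, -, hb, hfr⟩ := (dvd_monomial_iff_exists one_ne_zero).mp (Dvd.intro g hfg)
  refine ⟨castExp r - castExp s, b, ?_, ?_⟩
  · rintro rfl
    exact one_ne_zero (zero_dvd_iff.mp hb)
  · apply (isUnit_toLaurent_monomial s).mul_left_cancel
    rw [hf, hfr, toLaurent_monomial, toLaurent_monomial, AddMonoidAlgebra.single_mul_single,
      one_mul, add_sub_cancel]

theorem toLaurent_dvd_toLaurent_iff {q F : MvPolynomial (Fin m) ℂ} (hq : Prime q)
    (hX : ∀ k, ¬ q ∣ X k) : toLaurent q ∣ toLaurent F ↔ q ∣ F := by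
  refine ⟨?_, fun h => map_dvd _ h⟩
  rintro ⟨h, hh⟩
  obtain ⟨s, f, hf⟩ := exists_toLaurent_eq_mul h
  have h1 : monomial s 1 * F = q * f := by
    apply toLaurent_injective
    rw [map_mul, map_mul, hh, ← hf]
    ring
  refine (hq.dvd_or_dvd (Dvd.intro _ h1.symm)).resolve_left fun h2 => ?_
  rw [monomial_eq, map_one, one_mul, Finsupp.prod, hq.dvd_finsetProd_iff] at h2
  obtain ⟨k, -, hk⟩ := h2
  exact hX k (hq.dvd_of_dvd_pow hk)

/-! ### Evaluation, monomial substitution and torus action on Laurent polynomials -/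

/-- Evaluation of Laurent polynomials at a point of the torus. -/
noncomputable def evalLaurent {K : Type} [Field K] [Algebra ℂ K] (y : Fin m → Kˣ) :
    Laurent m →ₐ[ℂ] K :=
  AddMonoidAlgebra.lift ℂ K (Fin m → ℤ)
    { toFun := fun w => ((∏ i, y i ^ Multiplicative.toAdd w i : Kˣ) : K)
      map_one' := by simp
      map_mul' := fun v w => by simp [zpow_add, Finset.prod_mul_distrib] }

theorem evalLaurent_single {K : Type} [Field K] [Algebra ℂ K] (y : Fin m → Kˣ)
    (w : Fin m → ℤ) (a : ℂ) :
    evalLaurent y (AddMonoidAlgebra.single w a) = a • ((∏ i, y i ^ w i : Kˣ) : K) :=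
  AddMonoidAlgebra.lift_single _ _ _

theorem evalLaurent_toLaurent {K : Type} [Field K] [Algebra ℂ K] (y : Fin m → Kˣ)
    (f : MvPolynomial (Fin m) ℂ) :
    evalLaurent y (toLaurent f) = aeval (fun k => (y k : K)) f := by
  have : (evalLaurent y).comp toLaurent = aeval (fun k => (y k : K)) := by
    apply MvPolynomial.algHom_ext
    intro k
    rw [AlgHom.comp_apply, toLaurent, aeval_X, aeval_X, mono, evalLaurent_single, one_smul,
      Finset.prod_eq_single k]
    · simp
    · intro b _ hb
      simp [Pi.single_eq_of_ne hb]
    · simp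
  exact DFunLike.congr_fun this f

/-- The substitution `y ↦ α_M(y)` in Laurent polynomials. -/
noncomputable def monoMap (M : Matrix (Fin m) (Fin m) ℤ) : Laurent m →ₐ[ℂ] Laurent m :=
  AddMonoidAlgebra.mapDomainAlgHom ℂ ℂ (M.mulVecLin.toAddMonoidHom)

theorem monoMap_single (M : Matrix (Fin m) (Fin m) ℤ) (w : Fin m → ℤ) (a : ℂ) :
    monoMap M (AddMonoidAlgebra.single w a) = AddMonoidAlgebra.single (M.mulVec w) a := by
  simp [monoMap]

theorem compAlpha_eq_monoMap (M : Matrix (Fin m) (Fin m) ℤ) (f : MvPolynomial (Fin m) ℂ) :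
    compAlpha M f = monoMap M (toLaurent f) := by
  have : compAlpha M = (monoMap M).comp toLaurent := by
    apply MvPolynomial.algHom_ext
    intro k
    rw [AlgHom.comp_apply, toLaurent, compAlpha, aeval_X, aeval_X, mono, mono, monoMap_single,
      Matrix.mulVec_single_one]
  exact DFunLike.congr_fun this f

theorem evalLaurent_monoMap {K : Type} [Field K] [Algebra ℂ K] (y : Fin m → Kˣ)
    (M : Matrix (Fin m) (Fin m) ℤ) (h : Laurent m) :
    evalLaurent y (monoMap M h) = evalLaurent (fun k => ∏ i, y i ^ M i k) h := by
  have : (evalLaurent y).comp (monoMap M) = evalLaurent (fun k => ∏ i, y i ^ M i k) := by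
    refine AddMonoidAlgebra.algHom_ext (fun w => ?_) (Subsingleton.elim _ _)
    rw [AlgHom.comp_apply, monoMap_single, evalLaurent_single, evalLaurent_single,
      prod_zpow_mulVec]
  exact DFunLike.congr_fun this h

/-- The substitution `y ↦ ε · y` in Laurent polynomials. -/
noncomputable def laurentScale (ε : Fin m → ℂˣ) : Laurent m →ₐ[ℂ] Laurent m :=
  AddMonoidAlgebra.lift ℂ (Laurent m) (Fin m → ℤ)
    { toFun := fun w => AddMonoidAlgebra.single (Multiplicative.toAdd w)
        ((∏ i, ε i ^ Multiplicative.toAdd w i : ℂˣ) : ℂ)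
      map_one' := by simp [AddMonoidAlgebra.one_def]
      map_mul' := fun v w => by
        rw [AddMonoidAlgebra.single_mul_single, ← Units.val_mul, ← Finset.prod_mul_distrib]
        simp only [← zpow_add]
        rfl }

theorem laurentScale_single (ε : Fin m → ℂˣ) (w : Fin m → ℤ) (a : ℂ) :
    laurentScale ε (AddMonoidAlgebra.single w a) =
      AddMonoidAlgebra.single w (((∏ i, ε i ^ w i : ℂˣ) : ℂ) * a) := by
  rw [laurentScale, AddMonoidAlgebra.lift_single]
  show a • AddMonoidAlgebra.single w _ = _
  rw [AddMonoidAlgebra.smul_single, smul_eq_mul, mul_comm]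
  rfl

theorem coeff_laurentScale (ε : Fin m → ℂˣ) (h : Laurent m) (w : Fin m → ℤ) :
    (laurentScale ε h).coeff w = ((∏ i, ε i ^ w i : ℂˣ) : ℂ) * h.coeff w := by
  classical
  induction h using AddMonoidAlgebra.induction_linear with
  | zero => simp
  | add p q hp hq => simp [hp, hq, mul_add]
  | single v a =>
    rw [laurentScale_single, AddMonoidAlgebra.coeff_single, AddMonoidAlgebra.coeff_single,
      Finsupp.single_apply, Finsupp.single_apply]
    split_ifs with h
    · rw [h]
    · rw [mul_zero]

theorem laurentScale_toLaurent (ε : Fin m → ℂˣ) (f : MvPolynomial (Fin m) ℂ) :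
    laurentScale ε (toLaurent f) = toLaurent (scale ε f) := by
  have : (laurentScale ε).comp toLaurent = toLaurent.comp (scale ε) := by
    apply MvPolynomial.algHom_ext
    intro k
    have hC : toLaurent (MvPolynomial.C (ε k : ℂ)) = algebraMap ℂ (Laurent m) (ε k) :=
      toLaurent.commutes _
    rw [AlgHom.comp_apply, AlgHom.comp_apply, scale_X, map_mul, hC, toLaurent, aeval_X, mono,
      laurentScale_single, ← Algebra.smul_def, AddMonoidAlgebra.smul_single, smul_eq_mul,
      Finset.prod_eq_single k]
    · simp
    · intro b _ hb
      simp [Pi.single_eq_of_ne hb]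
    · simp
  exact DFunLike.congr_fun this f

theorem coeff_eq_zero_of_notMem {M : Matrix (Fin m) (Fin m) ℤ} (h : Laurent m) {w : Fin m → ℤ}
    (hw : w ∉ columnLattice M) : (monoMap M h).coeff w = 0 := by
  classical
  induction h using AddMonoidAlgebra.induction_linear with
  | zero => simp
  | add p q hp hq => simp [hp, hq]
  | single v a =>
    rw [monoMap_single, AddMonoidAlgebra.coeff_single, Finsupp.single_apply, if_neg]
    rintro rfl
    exact hw (mem_columnLattice_iff.mpr ⟨v, rfl⟩)

theorem exists_monoMap_eq {M : Matrix (Fin m) (Fin m) ℤ} {h : Laurent m}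
    (hw : ∀ w, h.coeff w ≠ 0 → w ∈ columnLattice M) : ∃ g, monoMap M g = h := by
  have h1 : h ∈ (monoMap M).range := by
    rw [← AddMonoidAlgebra.sum_coeff_single h]
    refine sum_mem fun w hmem => ?_
    obtain ⟨x, hx⟩ := mem_columnLattice_iff.mp (hw w (Finsupp.mem_support_iff.mp hmem))
    exact ⟨AddMonoidAlgebra.single x (h.coeff w), by rw [← hx]; exact monoMap_single M x _⟩
  exact h1

theorem laurentScale_monoMap {M : Matrix (Fin m) (Fin m) ℤ} {ε : Fin m → ℂˣ} (hε : ε ∈ G M)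
    (h : Laurent m) : laurentScale ε (monoMap M h) = monoMap M h := by
  have hε' : ∀ k, ∏ i, ε i ^ M i k = 1 := fun k => congrFun hε k
  have : (laurentScale ε).comp (monoMap M) = monoMap M := by
    refine AddMonoidAlgebra.algHom_ext (fun w => ?_) (Subsingleton.elim _ _)
    rw [AlgHom.comp_apply, monoMap_single, laurentScale_single, prod_zpow_mulVec]
    simp [hε']
  exact DFunLike.congr_fun this h

/-- G_M acts on y^w through the character ε^w, so invariance puts the support in ℤM by duality. -/
theorem exists_monoMap_eq_of_invariant {M : Matrix (Fin m) (Fin m) ℤ} (hM : M.det ≠ 0)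
    {h : Laurent m} (hh : ∀ ε ∈ G M, laurentScale ε h = h) : ∃ g, monoMap M g = h := by
  apply exists_monoMap_eq
  intro w hw
  rw [mem_columnLattice_iff_forall_G hM]
  intro ε hε
  have h1 := coeff_laurentScale ε h w
  rw [hh ε hε] at h1
  apply Units.ext
  exact (mul_eq_right₀ hw).mp h1.symm

/-! ### Comparison of the generic points of S_{CM} and S_C -/

theorem lin_mul (C : Matrix (Fin n) (Fin m) ℤ) (M : Matrix (Fin m) (Fin m) ℤ)
    {K : Type} [Field K] (i : Fin n) (v : Fin m → K) :
    lin (C * M) i v = lin C i fun j => ∑ k, (M j k : K) * v k := by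
  simp only [lin, Matrix.mul_apply, Int.cast_sum, Int.cast_mul, Finset.sum_mul, Finset.mul_sum]
  rw [Finset.sum_comm]
  exact Finset.sum_congr rfl fun j _ => Finset.sum_congr rfl fun k _ => by ring

/-- This is ψ_{CM}(u) = α_M(ψ_C(Mu)): M enters once through the linear forms and once through the
exponents. -/
theorem psiAt_mul (C : Matrix (Fin n) (Fin m) ℤ) (M : Matrix (Fin m) (Fin m) ℤ)
    {K : Type} [Field K] {v : Fin m → K} (hv : ∀ i, lin (C * M) i v ≠ 0) (k : Fin m) :
    psiAt (C * M) v k = ∏ j, psiAt C (fun j => ∑ k, (M j k : K) * v k) j ^ M j k := by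
  simp only [psiAt, ← Finset.prod_zpow, ← zpow_mul]
  rw [Finset.prod_comm]
  refine Finset.prod_congr rfl fun i _ => ?_
  rw [lin_mul] at *
  rw [Matrix.mul_apply, ← prod_zpow_const]
  rw [← lin_mul]
  exact hv i

theorem exists_linear_substitution {M : Matrix (Fin m) (Fin m) ℤ} (hM : M.det ≠ 0) :
    ∃ μ : FunField m →ₐ[ℂ] FunField m,
      ∀ j, μ (coord j) = ∑ k, (M j k : FunField m) * coord k := by
  set N : Matrix (Fin m) (Fin m) ℂ := M.map (Int.castRingHom ℂ) with hN
  have hdet : IsUnit N.det := by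
    rw [hN, ← RingHom.mapMatrix_apply, ← RingHom.map_det, isUnit_iff_ne_zero]
    simpa using hM
  let σ : Matrix (Fin m) (Fin m) ℂ → (MvPolynomial (Fin m) ℂ →ₐ[ℂ] MvPolynomial (Fin m) ℂ) :=
    fun A => aeval fun j => ∑ k, MvPolynomial.C (A j k) * X k
  have hσX : ∀ A j, σ A (X j) = ∑ k, MvPolynomial.C (A j k) * X k := fun A j => aeval_X _ _
  have hσC : ∀ A a, σ A (MvPolynomial.C a) = MvPolynomial.C a := fun A a => (σ A).commutes a
  have hinv : ∀ f, σ N⁻¹ (σ N f) = f := by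
    have : (σ N⁻¹).comp (σ N) = AlgHom.id ℂ _ := by
      apply MvPolynomial.algHom_ext
      intro j
      rw [AlgHom.comp_apply, hσX, map_sum]
      simp only [map_mul, hσC, hσX, Finset.mul_sum]
      rw [Finset.sum_comm]
      simp only [← mul_assoc, ← Finset.sum_mul, ← map_mul, ← map_sum, ← Matrix.mul_apply,
        Matrix.mul_nonsing_inv _ hdet, AlgHom.id_apply]
      rw [Finset.sum_eq_single j]
      · simp
      · intro b _ hb
        simp [Matrix.one_apply_ne (Ne.symm hb)]
      · simp
    exact fun f => DFunLike.congr_fun this f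
  let g : MvPolynomial (Fin m) ℂ →ₐ[ℂ] FunField m :=
    (IsScalarTower.toAlgHom ℂ (MvPolynomial (Fin m) ℂ) (FunField m)).comp (σ N)
  have hg : Function.Injective g :=
    (IsFractionRing.injective (MvPolynomial (Fin m) ℂ) (FunField m)).comp
      (Function.LeftInverse.injective hinv)
  refine ⟨IsFractionRing.liftAlgHom hg, fun j => ?_⟩
  rw [coord, IsFractionRing.liftAlgHom_apply, IsFractionRing.lift_algebraMap]
  show algebraMap (MvPolynomial (Fin m) ℂ) (FunField m) (σ N (X j)) = _
  rw [hσX, map_sum]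
  simp [hN, coord]

/-- The generic point of `S_C`, as a point of the torus. -/
noncomputable def genericPoint {C : Matrix (Fin n) (Fin m) ℤ} (hrow : ∀ i, C i ≠ 0) :
    Fin m → (FunField m)ˣ :=
  fun k => Units.mk0 (psiAt C coord k) (psiAt_ne_zero (fun i => lin_coord_ne_zero (hrow i)) k)

theorem evalLaurent_genericPoint_toLaurent {C : Matrix (Fin n) (Fin m) ℤ} (hrow : ∀ i, C i ≠ 0)
    (f : MvPolynomial (Fin m) ℂ) :
    evalLaurent (genericPoint hrow) (toLaurent f) = pullback C f := by
  rw [evalLaurent_toLaurent]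
  rfl

theorem pullback_mul_eq_zero_iff {C : Matrix (Fin n) (Fin m) ℤ} {M : Matrix (Fin m) (Fin m) ℤ}
    (hrow : ∀ i, C i ≠ 0) (hrow' : ∀ i, (C * M) i ≠ 0) (hM : M.det ≠ 0)
    (f : MvPolynomial (Fin m) ℂ) :
    pullback (C * M) f = 0 ↔ evalLaurent (genericPoint hrow) (compAlpha M f) = 0 := by
  obtain ⟨μ, hμ⟩ := exists_linear_substitution hM
  have hψ : (fun k => μ ((∏ i, genericPoint hrow i ^ M i k : (FunField m)ˣ) : FunField m)) =
      psiAt (C * M) coord := by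
    funext k
    rw [psiAt_mul C M fun i => lin_coord_ne_zero (hrow' i)]
    have hp : ∀ j, μ (psiAt C coord j) =
        psiAt C (fun j => ∑ k, (M j k : FunField m) * coord k) j := by
      intro j
      simp only [psiAt, lin, map_prod, map_zpow₀, map_sum, map_mul, map_intCast, hμ]
    simp only [Units.coe_prod, Units.val_zpow_eq_zpow_val, genericPoint,
      Units.val_mk0, map_prod, map_zpow₀, hp]
  have hmap : pullback (C * M) f = μ (evalLaurent (genericPoint hrow) (compAlpha M f)) := by
    rw [compAlpha_eq_monoMap, evalLaurent_monoMap, evalLaurent_toLaurent, comp_aeval_apply, hψ]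
    rfl
  rw [hmap, map_eq_zero]

theorem evalLaurent_genericPoint_eq_zero_iff {C : Matrix (Fin n) (Fin m) ℤ}
    (hrow : ∀ i, C i ≠ 0) {Δ : MvPolynomial (Fin m) ℂ}
    (hker : RingHom.ker (pullback C) = Ideal.span {Δ}) (h : Laurent m) :
    evalLaurent (genericPoint hrow) h = 0 ↔ toLaurent Δ ∣ h := by
  constructor
  · intro h0
    obtain ⟨s, f, hf⟩ := exists_toLaurent_eq_mul h
    have hmem : f ∈ RingHom.ker (pullback C) := by
      rw [RingHom.mem_ker, ← evalLaurent_genericPoint_toLaurent hrow, ← hf, map_mul, h0, mul_zero]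
    rw [hker, Ideal.mem_span_singleton] at hmem
    rw [← (isUnit_toLaurent_monomial s).dvd_mul_left, hf]
    exact map_dvd _ hmem
  · rintro ⟨g, rfl⟩
    have hmem : Δ ∈ RingHom.ker (pullback C) := by
      rw [hker]; exact Ideal.mem_span_singleton_self _
    rw [map_mul, evalLaurent_genericPoint_toLaurent, RingHom.mem_ker.mp hmem, zero_mul]

/-! ### The factorization up to a unit -/

/-- Scaling by a point of the torus as an automorphism. -/
noncomputable def scaleEquiv (ε : Fin m → ℂˣ) :
    MvPolynomial (Fin m) ℂ ≃ₐ[ℂ] MvPolynomial (Fin m) ℂ :=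
  AlgEquiv.ofAlgHom (scale ε) (scale ε⁻¹)
    (AlgHom.ext fun f => by
      rw [AlgHom.comp_apply, scale_scale, mul_inv_cancel, scale_one, AlgHom.id_apply])
    (AlgHom.ext fun f => by
      rw [AlgHom.comp_apply, scale_scale, inv_mul_cancel, scale_one, AlgHom.id_apply])

theorem prime_scale {Δ : MvPolynomial (Fin m) ℂ} (hΔ : Prime Δ) (ε : Fin m → ℂˣ) :
    Prime (scale ε Δ) :=
  (MulEquiv.prime_iff (scaleEquiv ε)).mpr hΔ

theorem scale_dvd_scale_iff {f g : MvPolynomial (Fin m) ℂ} (ε : Fin m → ℂˣ) :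
    scale ε f ∣ scale ε g ↔ f ∣ g :=
  map_dvd_iff (scaleEquiv ε)

/-- The generic point lies in the torus, so no variable vanishes on S_C; this lets divisibility by
translates of Δ pass between polynomials and Laurent polynomials. -/
theorem not_scale_dvd_X {C : Matrix (Fin n) (Fin m) ℤ} (hrow : ∀ i, C i ≠ 0)
    {Δ : MvPolynomial (Fin m) ℂ} (hker : RingHom.ker (pullback C) = Ideal.span {Δ})
    (ε : Fin m → ℂˣ) (k : Fin m) : ¬ scale ε Δ ∣ X k := by
  intro h
  have h1 : Δ ∣ scale ε⁻¹ (X k) := by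
    rw [← scale_dvd_scale_iff ε, scale_scale, mul_inv_cancel, scale_one]
    exact h
  rw [← Ideal.mem_span_singleton, ← hker, RingHom.mem_ker, scale_X, map_mul] at h1
  have hC : pullback C (MvPolynomial.C ((ε⁻¹ k : ℂˣ) : ℂ)) = algebraMap ℂ (FunField m) (ε⁻¹ k : ℂˣ) :=
    (pullback C).commutes _
  rw [hC, pullback, aeval_X] at h1
  rcases mul_eq_zero.mp h1 with h2 | h2
  · rw [map_eq_zero] at h2
    exact Units.ne_zero _ h2
  · exact psiAt_ne_zero (fun i => lin_coord_ne_zero (hrow i)) k h2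

theorem isRelPrime_scale {C : Matrix (Fin n) (Fin m) ℤ} (hrow : ∀ i, C i ≠ 0)
    (hreg : IsRegular C) {Δ : MvPolynomial (Fin m) ℂ}
    (hΔ : Irreducible Δ) (hker : RingHom.ker (pullback C) = Ideal.span {Δ})
    {ε ε' : Fin m → ℂˣ} (hne : ε ≠ ε') : IsRelPrime (scale ε Δ) (scale ε' Δ) := by
  have hp := fun ε => (prime_scale hΔ.prime ε).irreducible
  rw [(hp ε).isRelPrime_iff_not_dvd]
  intro hd
  have h1 : Δ ∣ scale (ε⁻¹ * ε') Δ := by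
    rw [← scale_dvd_scale_iff ε, scale_scale, mul_inv_cancel_left]
    exact hd
  obtain ⟨u, hu⟩ := (hΔ.dvd_irreducible_iff_associated (hp _)).mp h1
  obtain ⟨c, -, hc⟩ := isUnit_iff_eq_C_of_isReduced.mp u.isUnit
  have := eq_one_of_scale_eq hrow hreg hΔ hker (c := c) (by rw [← hu, hc, mul_comm])
  exact hne (inv_mul_eq_one.mp this)

theorem exists_unit_factorization {C : Matrix (Fin n) (Fin m) ℤ} {M : Matrix (Fin m) (Fin m) ℤ}
    (hrow : ∀ i, C i ≠ 0) (hrow' : ∀ i, (C * M) i ≠ 0) (hreg : IsRegular C) (hM : M.det ≠ 0)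
    [Fintype (G M)] {Δ₁ Δ₂ : MvPolynomial (Fin m) ℂ} (hΔ₂ : Irreducible Δ₂)
    (hker₁ : RingHom.ker (pullback (C * M)) = Ideal.span {Δ₁})
    (hker₂ : RingHom.ker (pullback C) = Ideal.span {Δ₂}) :
    ∃ v ∈ columnLattice M, ∃ c : ℂ, c ≠ 0 ∧
      compAlpha M Δ₁ = AddMonoidAlgebra.single v c *
        toLaurent (∏ ε : G M, scale (ε : Fin m → ℂˣ) Δ₂) := by
  set P := ∏ ε : G M, scale (ε : Fin m → ℂˣ) Δ₂ with hP
  have hinv : ∀ ε ∈ G M, laurentScale ε (toLaurent P) = toLaurent P := by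
    intro ε hε
    rw [laurentScale_toLaurent, hP, map_prod]
    simp only [scale_scale]
    exact congrArg toLaurent
      (Fintype.prod_equiv (Equiv.mulLeft (⟨ε, hε⟩ : G M)) _ _ fun _ => rfl)
  have hPne : toLaurent P ≠ 0 := by
    rw [Ne, ← map_zero toLaurent, toLaurent_injective.eq_iff]
    exact Finset.prod_ne_zero_iff.mpr fun ε _ => (prime_scale hΔ₂.prime _).ne_zero
  obtain ⟨g, hg⟩ := exists_monoMap_eq_of_invariant hM hinv
  -- the product divides the pullback of `Δ₁`
  have hdvd : toLaurent P ∣ compAlpha M Δ₁ := by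
    have h1 : toLaurent Δ₂ ∣ compAlpha M Δ₁ := by
      rw [← evalLaurent_genericPoint_eq_zero_iff hrow hker₂,
        ← pullback_mul_eq_zero_iff hrow hrow' hM, ← RingHom.mem_ker, hker₁]
      exact Ideal.mem_span_singleton_self _
    obtain ⟨s, F, hF⟩ := exists_toLaurent_eq_mul (compAlpha M Δ₁)
    rw [← (isUnit_toLaurent_monomial s).dvd_mul_left, hF]
    refine map_dvd _ (Finset.prod_dvd_of_isRelPrime ?_ ?_)
    · intro ε _ ε' _ hne
      exact isRelPrime_scale hrow hreg hΔ₂ hker₂ fun h => hne (Subtype.ext h)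
    · intro ε _
      rw [← toLaurent_dvd_toLaurent_iff (prime_scale hΔ₂.prime _) (not_scale_dvd_X hrow hker₂ _),
        ← hF, (isUnit_toLaurent_monomial s).dvd_mul_left, ← laurentScale_toLaurent]
      have := map_dvd (laurentScale (ε : Fin m → ℂˣ)) h1
      rwa [compAlpha_eq_monoMap, laurentScale_monoMap ε.2, ← compAlpha_eq_monoMap] at this
  -- the pullback of `Δ₁` divides the product
  have hdvd' : compAlpha M Δ₁ ∣ toLaurent P := by
    -- Up to a monomial unit P is F ∘ α_M. Its factor at ε = 1 is Δ₂, so F vanishes at the generic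
    -- point of S_{CM} and is a multiple of Δ₁.
    obtain ⟨s, F, hF⟩ := exists_toLaurent_eq_mul g
    have hu : IsUnit (monoMap M (toLaurent (monomial s 1))) :=
      (isUnit_toLaurent_monomial s).map (monoMap M)
    have hcomp : compAlpha M F = monoMap M (toLaurent (monomial s 1)) * toLaurent P := by
      rw [compAlpha_eq_monoMap, ← hF, map_mul, hg]
    have hmem : F ∈ RingHom.ker (pullback (C * M)) := by
      rw [RingHom.mem_ker, pullback_mul_eq_zero_iff hrow hrow' hM, hcomp,
        evalLaurent_genericPoint_eq_zero_iff hrow hker₂]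
      refine Dvd.dvd.mul_left (map_dvd _ ?_) _
      have := Finset.dvd_prod_of_mem (fun ε : G M => scale (ε : Fin m → ℂˣ) Δ₂)
        (Finset.mem_univ 1)
      rwa [OneMemClass.coe_one, scale_one] at this
    rw [hker₁, Ideal.mem_span_singleton] at hmem
    rw [← hu.dvd_mul_left, ← hcomp]
    exact map_dvd _ hmem
  obtain ⟨u, hu⟩ := associated_of_dvd_dvd hdvd hdvd'
  obtain ⟨v, c, hc, huv⟩ := exists_eq_single_of_isUnit u.isUnit
  rw [huv, mul_comm] at hu
  refine ⟨v, ?_, c, hc, hu.symm⟩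
  -- Both sides are supported in ℤM and differ by the shift v: one exponent w of P gives w and v + w
  -- in ℤM.
  obtain ⟨w, hw⟩ : ∃ w, (toLaurent P).coeff w ≠ 0 := by
    by_contra! h
    exact hPne (AddMonoidAlgebra.ext (Finsupp.ext h))
  have hwmem : w ∈ columnLattice M := by
    by_contra h
    rw [← hg] at hw
    exact hw (coeff_eq_zero_of_notMem g h)
  have hvw : v + w ∈ columnLattice M := by
    by_contra h
    have h1 := coeff_eq_zero_of_notMem (toLaurent Δ₁) h
    rw [← compAlpha_eq_monoMap, ← hu, AddMonoidAlgebra.coeff_single_mul_apply, neg_add_cancel_left]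
      at h1
    exact mul_ne_zero hc hw h1
  exact (Submodule.add_mem_iff_left _ hwmem).mp hvw

/-! ### Existence of an integral equation of content one -/

theorem isDiscriminant_of_associated {C : Matrix (Fin n) (Fin m) ℤ} (hrow : ∀ i, C i ≠ 0)
    {Δ : MvPolynomial (Fin m) ℂ} (hΔ : Irreducible Δ)
    (hker : RingHom.ker (pullback C) = Ideal.span {Δ}) {D : MvPolynomial (Fin m) ℤ}
    (hass : Associated (toComplex D) Δ) (hD : (D.support.gcd fun a => D.coeff a) = 1) :
    IsDiscriminant C D := by
  refine ⟨hass.irreducible_iff.mpr hΔ, ?_, hD⟩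
  rw [S, vanishingIdeal_psiImage, vanishingIdeal_S hrow, hker,
    ← Ideal.span_singleton_eq_span_singleton.mpr hass]
  ext y
  simp only [Set.mem_ofPred_eq, mem_zeroLocus_iff, Ideal.mem_span_singleton]
  constructor
  · rintro h p ⟨q, rfl⟩
    rw [map_mul, aeval_eq_eval, h, zero_mul]
  · intro h
    simpa [aeval_eq_eval] using h _ dvd_rfl

theorem exists_content_one_multiple {p : MvPolynomial (Fin m) ℚ} (hp : p ≠ 0) :
    ∃ (D : MvPolynomial (Fin m) ℤ) (a b : ℤ), a ≠ 0 ∧ b ≠ 0 ∧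
      MvPolynomial.C (a : ℚ) * map (Int.castRingHom ℚ) D = MvPolynomial.C (b : ℚ) * p ∧
      (D.support.gcd fun s => D.coeff s) = 1 := by
  classical
  obtain ⟨b, hb⟩ := IsLocalization.exist_integer_multiples (nonZeroDivisors ℤ) p.support
    fun s => p.coeff s
  have hb' : ∀ s, ∃ a : ℤ, s ∈ p.support → (a : ℚ) = (b : ℤ) * p.coeff s := by
    intro s
    by_cases hs : s ∈ p.support
    · obtain ⟨a, ha⟩ := hb s hs
      refine ⟨a, fun _ => ?_⟩
      simpa [Algebra.smul_def] using ha
    · exact ⟨0, fun h => absurd h hs⟩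
  choose a ha using hb'
  have hb0 : ((b : ℤ) : ℚ) ≠ 0 := by
    exact_mod_cast nonZeroDivisors.ne_zero b.2
  have ha0 : ∀ s ∈ p.support, a s ≠ 0 := by
    intro s hs h0
    have := ha s hs
    rw [h0, Int.cast_zero] at this
    exact mul_ne_zero hb0 (mem_support_iff.mp hs) this.symm
  have hne : p.support.Nonempty := by
    rw [Finset.nonempty_iff_ne_empty, Ne, support_eq_empty]; exact hp
  obtain ⟨g, hg, hg1⟩ := Finset.extract_gcd a hne
  let D : MvPolynomial (Fin m) ℤ := ∑ s ∈ p.support, monomial s (g s)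
  have hD : ∀ s, D.coeff s = if s ∈ p.support then g s else 0 := by
    intro s
    simp only [D, coeff_sum, coeff_monomial]
    rw [Finset.sum_ite_eq']
  have hg0 : ∀ s ∈ p.support, g s ≠ 0 := by
    intro s hs h0
    apply ha0 s hs
    rw [hg s hs, h0, mul_zero]
  have hsupp : D.support = p.support := by
    ext s
    rw [mem_support_iff, hD]
    by_cases hs : s ∈ p.support
    · simp only [hs, if_true, iff_true]; exact hg0 s hs
    · simp only [hs, if_false]; simp
  refine ⟨D, p.support.gcd a, b, ?_, nonZeroDivisors.ne_zero b.2, ?_, ?_⟩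
  · obtain ⟨s, hs⟩ := hne
    intro h0
    apply ha0 s hs
    rw [hg s hs, h0, zero_mul]
  · ext s
    rw [coeff_C_mul, coeff_C_mul, coeff_map, hD]
    by_cases hs : s ∈ p.support
    · rw [if_pos hs, ← ha s hs]
      conv_rhs => rw [hg s hs]
      simp
    · rw [if_neg hs, map_zero, mul_zero, notMem_support_iff.mp hs, mul_zero]
  · rw [hsupp, ← hg1]
    exact Finset.gcd_congr rfl fun s hs => by rw [hD, if_pos hs]

theorem lin_ratCast (C : Matrix (Fin n) (Fin m) ℤ) (i : Fin n) (v : Fin m → ℚ) :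
    lin C i (fun k => (v k : ℂ)) = (lin C i v : ℚ) := by
  simp [lin]

theorem psiAt_ratCast (C : Matrix (Fin n) (Fin m) ℤ) (v : Fin m → ℚ) (k : Fin m) :
    psiAt C (fun k => (v k : ℂ)) k = (psiAt C v k : ℚ) := by
  simp [psiAt, lin_ratCast]

theorem eq_zero_of_aeval_ratCast {F : MvPolynomial (Fin m) ℂ}
    (hF : ∀ u ∈ Set.range fun (v : Fin m → ℚ) (k : Fin m) => (v k : ℂ), aeval u F = 0) :
    F = 0 := by
  apply funext_set (fun _ => Set.range ((↑) : ℚ → ℂ))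
    (fun _ => Set.infinite_range_of_injective Rat.cast_injective)
  intro x hx
  have hx' : ∀ k, ∃ q : ℚ, (q : ℂ) = x k := fun k => hx k trivial
  choose v hv using hx'
  have := hF x ⟨v, funext hv⟩
  simpa [aeval_eq_eval] using this

/-- Apply a ℚ-linear functional φ : ℂ → ℚ, nonzero on some coefficient of Δ, to all coefficients.
The result p still vanishes at ψ_C(v) for rational v, because ψ_C(v) is rational; by density Δ
divides p, and p has no larger degree. -/
theorem exists_rational_multiple {C : Matrix (Fin n) (Fin m) ℤ} (hrow : ∀ i, C i ≠ 0)
    {Δ : MvPolynomial (Fin m) ℂ} (hΔ : Irreducible Δ)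
    (hker : RingHom.ker (pullback C) = Ideal.span {Δ}) :
    ∃ p : MvPolynomial (Fin m) ℚ, p ≠ 0 ∧ Associated (map (algebraMap ℚ ℂ) p) Δ := by
  classical
  obtain ⟨s₀, hs₀⟩ := ne_zero_iff.mp hΔ.ne_zero
  obtain ⟨φ, hφ⟩ : ∃ φ : Module.Dual ℚ ℂ, φ (Δ.coeff s₀) ≠ 0 := by
    by_contra! h
    exact hs₀ ((Module.forall_dual_apply_eq_zero_iff ℚ _).mp h)
  let p : MvPolynomial (Fin m) ℚ := ∑ s ∈ Δ.support, monomial s (φ (Δ.coeff s))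
  have hp : ∀ s, p.coeff s = φ (Δ.coeff s) := by
    intro s
    simp only [p, coeff_sum, coeff_monomial]
    rw [Finset.sum_ite_eq']
    split_ifs with h
    · rfl
    · rw [notMem_support_iff.mp h, map_zero]
  have hp0 : p ≠ 0 := ne_zero_iff.mpr ⟨s₀, by rwa [hp]⟩
  have hpm0 : map (algebraMap ℚ ℂ) p ≠ 0 := by
    rwa [Ne, map_eq_zero_iff _ (map_injective _ (algebraMap ℚ ℂ).injective)]
  have heval : ∀ y : Fin m → ℚ, aeval (fun k => (y k : ℂ)) Δ = 0 → eval y p = 0 := by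
    intro y hy
    have h1 : aeval (fun k => (y k : ℂ)) Δ =
        ∑ s ∈ Δ.support, (∏ i, y i ^ s i : ℚ) • Δ.coeff s := by
      rw [aeval_eq_eval, eval_eq']
      refine Finset.sum_congr rfl fun s _ => ?_
      rw [Rat.smul_def, mul_comm]
      push_cast
      rfl
    have h2 : eval y p = ∑ s ∈ Δ.support, (∏ i, y i ^ s i : ℚ) • φ (Δ.coeff s) := by
      simp only [p, map_sum, eval_monomial, smul_eq_mul]
      refine Finset.sum_congr rfl fun s _ => ?_
      rw [mul_comm, Finsupp.prod_fintype _ _ fun i => pow_zero _]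
    rw [h2, ← map_zero φ, ← hy, h1, map_sum]
    exact Finset.sum_congr rfl fun s _ => (map_smul φ _ _).symm
  have hmem : map (algebraMap ℚ ℂ) p ∈ RingHom.ker (pullback C) := by
    rw [RingHom.mem_ker, pullback, aeval_psiAt_coord_eq_zero_iff hrow _ _
      fun F hF => eq_zero_of_aeval_ratCast hF]
    rintro _ ⟨v, rfl⟩ hv
    have h0 : aeval (psiAt C fun k => (v k : ℂ)) Δ = 0 := by
      have : Δ ∈ RingHom.ker (pullback C) := by
        rw [hker]; exact Ideal.mem_span_singleton_self _
      rw [RingHom.mem_ker, pullback, aeval_psiAt_coord_eq_zero_iff hrow _ _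
        fun F hF => eq_zero_of_aeval_ratCast hF] at this
      exact this _ ⟨v, rfl⟩ hv
    have hψ : (psiAt C fun k => (v k : ℂ)) = fun k => ((psiAt C v k : ℚ) : ℂ) :=
      funext fun k => psiAt_ratCast C v k
    rw [hψ] at h0 ⊢
    have h1 := heval _ h0
    rw [aeval_eq_eval, eval_map]
    have h2 := (eval₂_comp (algebraMap ℚ ℂ) (psiAt C v) p).symm
    have h3 : (fun k => ((psiAt C v k : ℚ) : ℂ)) = algebraMap ℚ ℂ ∘ psiAt C v := rfl
    rw [h3, h2]
    erw [h1]
    exact map_zero _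
  refine ⟨p, hp0, ?_⟩
  rw [hker, Ideal.mem_span_singleton] at hmem
  obtain ⟨q, hq⟩ := hmem
  have hq0 : q ≠ 0 := by rintro rfl; exact hpm0 (by rw [hq, mul_zero])
  have hdeg : (map (algebraMap ℚ ℂ) p).totalDegree ≤ Δ.totalDegree := by
    apply totalDegree_le_of_support_subset
    intro s hs
    rw [mem_support_iff, coeff_map, hp] at hs
    rw [mem_support_iff]
    intro h
    rw [h, map_zero, map_zero] at hs
    exact hs rfl
  rw [hq, totalDegree_mul_of_isDomain hΔ.ne_zero hq0] at hdeg
  have hq1 : q.totalDegree = 0 := by omega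
  have hqC := totalDegree_eq_zero_iff_eq_C.mp hq1
  have hqu : IsUnit q := by
    rw [isUnit_iff_eq_C_of_isReduced]
    refine ⟨_, isUnit_iff_ne_zero.mpr ?_, hqC⟩
    intro h
    rw [h, map_zero] at hqC
    exact hq0 hqC
  rw [hq]
  exact (associated_mul_unit_left _ _ hqu)

theorem exists_isDiscriminant {C : Matrix (Fin n) (Fin m) ℤ} (hrow : ∀ i, C i ≠ 0)
    {Δ : MvPolynomial (Fin m) ℂ} (hΔ : Irreducible Δ)
    (hker : RingHom.ker (pullback C) = Ideal.span {Δ}) : ∃ D, IsDiscriminant C D := by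
  obtain ⟨p, hp, hass⟩ := exists_rational_multiple hrow hΔ hker
  obtain ⟨D, a, b, ha, hb, hD, hgcd⟩ := exists_content_one_multiple hp
  refine ⟨D, isDiscriminant_of_associated hrow hΔ hker (Associated.trans ?_ hass) hgcd⟩
  have hunit : ∀ z : ℤ, z ≠ 0 → IsUnit (z : MvPolynomial (Fin m) ℂ) := by
    intro z hz
    have := (isUnit_iff_ne_zero.mpr (Int.cast_ne_zero.mpr hz : (z : ℂ) ≠ 0)).map
      (MvPolynomial.C (σ := Fin m))
    rwa [map_intCast] at this
  have h1 := congrArg (map (algebraMap ℚ ℂ)) hD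
  simp only [map_mul, map_intCast, map_map] at h1
  have h2 : map ((algebraMap ℚ ℂ).comp (Int.castRingHom ℚ)) D = toComplex D := by
    rw [toComplex]; congr 1
  rw [h2] at h1
  have h3 : Associated ((a : MvPolynomial (Fin m) ℂ) * toComplex D) (toComplex D) :=
    associated_unit_mul_left _ _ (hunit a ha)
  refine h3.symm.trans ?_
  rw [h1]
  exact associated_unit_mul_left _ _ (hunit b hb)

/-! ### The constant is ±1: Gauss's lemma over the algebraic integers -/

theorem not_isUnit_prime_integralClosure {p : ℕ} (hp : p.Prime) :
    ¬ IsUnit (p : integralClosure ℤ ℂ) := by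
  intro h
  obtain ⟨x, hx⟩ := h.exists_right_inv
  have hx' : (p : ℂ) * x = 1 := congrArg Subtype.val hx
  have hp0 : (p : ℚ) ≠ 0 := Nat.cast_ne_zero.mpr hp.ne_zero
  have hxq : (x : ℂ) = algebraMap ℚ ℂ (1 / p) := by
    have : (p : ℂ) ≠ 0 := Nat.cast_ne_zero.mpr hp.ne_zero
    rw [← mul_right_inj' this, hx']
    simp [this]
  have hint : IsIntegral ℤ (1 / p : ℚ) := by
    have h1 : IsIntegral ℤ (x : ℂ) := x.2
    rw [hxq] at h1
    exact (isIntegral_algebraMap_iff (algebraMap ℚ ℂ).injective).mp h1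
  obtain ⟨z, hz⟩ := IsIntegrallyClosed.isIntegral_iff.mp hint
  have hz' : (z : ℚ) = 1 / p := hz
  rw [eq_div_iff hp0] at hz'
  have h2 : z * p = 1 := by exact_mod_cast hz'
  have h3 : IsUnit (p : ℤ) := IsUnit.of_mul_eq_one_right z h2
  exact hp.one_lt.ne' (by simpa using Int.isUnit_iff.mp h3)

theorem exists_prime_ideal_over {p : ℕ} (hp : p.Prime) :
    ∃ 𝔭 : Ideal (integralClosure ℤ ℂ), 𝔭.IsPrime ∧ (p : integralClosure ℤ ℂ) ∈ 𝔭 := by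
  obtain ⟨𝔭, h𝔭, hle⟩ := Ideal.exists_le_maximal (Ideal.span {(p : integralClosure ℤ ℂ)})
    (by rw [Ne, Ideal.span_singleton_eq_top]; exact not_isUnit_prime_integralClosure hp)
  exact ⟨𝔭, h𝔭.isPrime, hle (Ideal.mem_span_singleton_self _)⟩

theorem intCast_mem_iff {𝔭 : Ideal (integralClosure ℤ ℂ)} (h𝔭 : 𝔭.IsPrime) {p : ℕ} (hp : p.Prime)
    (hmem : (p : integralClosure ℤ ℂ) ∈ 𝔭) (z : ℤ) :
    (z : integralClosure ℤ ℂ) ∈ 𝔭 ↔ (p : ℤ) ∣ z := by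
  constructor
  · intro hz
    by_contra hd
    have hcop : IsCoprime (p : ℤ) z := (Nat.prime_iff_prime_int.mp hp).coprime_iff_not_dvd.mpr hd
    obtain ⟨a, b, hab⟩ := hcop
    apply h𝔭.ne_top
    rw [Ideal.eq_top_iff_one]
    have h1 : (a : integralClosure ℤ ℂ) * p + b * z = 1 := by
      exact_mod_cast congrArg (Int.cast (R := integralClosure ℤ ℂ)) hab
    rw [← h1]
    exact add_mem (𝔭.mul_mem_left _ hmem) (𝔭.mul_mem_left _ hz)
  · rintro ⟨k, rfl⟩
    push_cast
    exact 𝔭.mul_mem_right _ hmem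

/-- The last hypothesis makes c rational. A prime dividing its denominator contradicts primitivity
of B modulo a prime ideal above it, and one dividing its numerator contradicts primitivity of A. -/
theorem eq_one_or_eq_neg_one_of_primitive {ι : Type*} {c : ℂ} (A : ι → ℤ)
    (B : ι → integralClosure ℤ ℂ) (h : ∀ w, (A w : ℂ) = c * B w)
    (hA : ∀ p : ℕ, p.Prime → ∃ w, ¬ (p : ℤ) ∣ A w)
    (hB : ∀ 𝔭 : Ideal (integralClosure ℤ ℂ), 𝔭.IsPrime → ∀ p : ℕ, p.Prime →
      (p : integralClosure ℤ ℂ) ∈ 𝔭 → ∃ w, B w ∉ 𝔭)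
    (hint : ∃ w, ∃ b : ℤ, b ≠ 0 ∧ (B w : ℂ) = b) : c = 1 ∨ c = -1 := by
  obtain ⟨w₀, b₀, hb₀, hBw⟩ := hint
  obtain ⟨q, rfl⟩ : ∃ q : ℚ, (q : ℂ) = c := by
    refine ⟨A w₀ / b₀, ?_⟩
    have hb₀' : (b₀ : ℂ) ≠ 0 := Int.cast_ne_zero.mpr hb₀
    push_cast
    rw [h w₀, hBw, mul_div_cancel_right₀ _ hb₀']
  have hq : ∀ w, ((q.den : ℤ) : integralClosure ℤ ℂ) * A w = q.num * B w := by
    intro w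
    apply Subtype.ext
    push_cast
    rw [h w, ← mul_assoc]
    congr 1
    exact_mod_cast Rat.den_mul_eq_num q
  have hden : q.den = 1 := by
    by_contra hne
    obtain ⟨p, hp, hpd⟩ := Nat.exists_prime_and_dvd hne
    obtain ⟨𝔭, h𝔭, hmem⟩ := exists_prime_ideal_over hp
    obtain ⟨w, hw⟩ := hB 𝔭 h𝔭 p hp hmem
    have h1 : (q.num : integralClosure ℤ ℂ) * B w ∈ 𝔭 := by
      rw [← hq w]
      exact 𝔭.mul_mem_right _
        ((intCast_mem_iff h𝔭 hp hmem _).mpr (Int.natCast_dvd_natCast.mpr hpd))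
    have h2 := (intCast_mem_iff h𝔭 hp hmem _).mp ((h𝔭.mem_or_mem h1).resolve_right hw)
    have h3 := Nat.dvd_gcd (Int.natCast_dvd.mp h2) hpd
    rw [q.reduced] at h3
    exact hp.one_lt.ne' (Nat.dvd_one.mp h3)
  have hnum : q.num.natAbs = 1 := by
    by_contra hne
    obtain ⟨p, hp, hpd⟩ := Nat.exists_prime_and_dvd hne
    obtain ⟨𝔭, h𝔭, hmem⟩ := exists_prime_ideal_over hp
    obtain ⟨w, hw⟩ := hA p hp
    apply hw
    rw [← intCast_mem_iff h𝔭 hp hmem]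
    have h1 := hq w
    rw [hden, Nat.cast_one, Int.cast_one, one_mul] at h1
    rw [h1]
    exact 𝔭.mul_mem_right _ ((intCast_mem_iff h𝔭 hp hmem _).mpr (Int.natCast_dvd.mpr hpd))
  have hqn : (q : ℂ) = q.num := by
    conv_lhs => rw [← Rat.coe_int_num_of_den_eq_one hden]
    simp
  rcases Int.natAbs_eq q.num with h1 | h1
  · left; rw [hqn, h1, hnum]; simp
  · right; rw [hqn, h1, hnum]; simp

/-- The polynomial `f(e · y)` over an arbitrary ring. -/
noncomputable def scaleBy {R : Type*} [CommRing R] (e : Fin m → R) :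
    MvPolynomial (Fin m) R →ₐ[R] MvPolynomial (Fin m) R :=
  aeval fun k => MvPolynomial.C (e k) * X k

theorem coeff_scaleBy {R : Type*} [CommRing R] (e : Fin m → R) (f : MvPolynomial (Fin m) R)
    (s : Fin m →₀ ℕ) : (scaleBy e f).coeff s = (∏ i, e i ^ s i) * f.coeff s := by
  classical
  induction f using MvPolynomial.induction_on' with
  | monomial t a =>
    have : scaleBy e (monomial t a) = monomial t ((∏ i, e i ^ t i) * a) := by
      rw [scaleBy, aeval_monomial, Finsupp.prod_fintype _ _ (fun i => pow_zero _)]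
      simp only [mul_pow, Finset.prod_mul_distrib]
      rw [monomial_eq, Finsupp.prod_fintype _ _ (fun i => pow_zero _), algebraMap_eq, map_mul,
        map_prod]
      simp only [map_pow]
      ring
    rw [this, coeff_monomial, coeff_monomial]
    split_ifs with h
    · rw [h]
    · rw [mul_zero]
  | add p q hp hq => simp [hp, hq, mul_add]

theorem map_scaleBy {R R' : Type*} [CommRing R] [CommRing R'] (φ : R →+* R') (e : Fin m → R)
    (f : MvPolynomial (Fin m) R) : map φ (scaleBy e f) = scaleBy (φ ∘ e) (map φ f) := by
  ext s
  simp [coeff_map, coeff_scaleBy]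

theorem scale_eq_scaleBy (ε : Fin m → ℂˣ) (f : MvPolynomial (Fin m) ℂ) :
    scale ε f = scaleBy (fun k => (ε k : ℂ)) f := rfl

theorem scaleBy_ne_zero {R : Type*} [CommRing R] [IsDomain R] {e : Fin m → R} (he : ∀ k, e k ≠ 0)
    {f : MvPolynomial (Fin m) R} (hf : f ≠ 0) : scaleBy e f ≠ 0 := by
  obtain ⟨s, hs⟩ := ne_zero_iff.mp hf
  refine ne_zero_iff.mpr ⟨s, ?_⟩
  rw [coeff_scaleBy]
  exact mul_ne_zero (Finset.prod_ne_zero_iff.mpr fun i _ => pow_ne_zero _ (he i)) hs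

/-- Coordinates of elements of Γ are roots of unity, hence algebraic integers that stay nonzero
modulo 𝔭. Modulo 𝔭 each factor is then nonzero, and so is the product, over a domain. -/
theorem exists_integral_model (Γ : Subgroup (Fin m → ℂˣ)) [Fintype Γ]
    (D : MvPolynomial (Fin m) ℤ) :
    ∃ P : MvPolynomial (Fin m) (integralClosure ℤ ℂ),
      map (algebraMap (integralClosure ℤ ℂ) ℂ) P =
        ∏ ε : Γ, scale (ε : Fin m → ℂˣ) (toComplex D) ∧
      ∀ 𝔭 : Ideal (integralClosure ℤ ℂ), 𝔭.IsPrime → 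
        (∃ s, ((D.coeff s : ℤ) : integralClosure ℤ ℂ) ∉ 𝔭) →
        ∃ s, P.coeff s ∉ 𝔭 := by
  have hpow : ∀ (ε : Γ) k, ((ε : Fin m → ℂˣ) k : ℂ) ^ Fintype.card Γ = 1 := by
    intro ε k
    have h1 : ε ^ Fintype.card Γ = 1 := pow_card_eq_one
    have h2 := congrArg Subtype.val h1
    have h3 := congrArg Units.val (congrFun h2 k)
    rw [← Units.val_pow_eq_pow_val]
    exact h3
  let e : Γ → Fin m → integralClosure ℤ ℂ := fun ε k =>
    ⟨((ε : Fin m → ℂˣ) k : ℂ), IsIntegral.of_pow Fintype.card_pos (by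
      rw [hpow]; exact isIntegral_one)⟩
  have he : ∀ ε k, e ε k ^ Fintype.card Γ = 1 := fun ε k => Subtype.ext (hpow ε k)
  refine ⟨∏ ε, scaleBy (e ε) (map (Int.castRingHom _) D), ?_, ?_⟩
  · rw [map_prod]
    refine Finset.prod_congr rfl fun ε _ => ?_
    rw [map_scaleBy, map_map, scale_eq_scaleBy, toComplex]
    rfl
  · rintro 𝔭 h𝔭 ⟨s, hs⟩
    by_contra! hall
    let φ := Ideal.Quotient.mk 𝔭
    have hzero : map φ (∏ ε, scaleBy (e ε) (map (Int.castRingHom _) D)) = 0 := by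
      ext t
      rw [coeff_map, coeff_zero]
      exact Ideal.Quotient.eq_zero_iff_mem.mpr (hall t)
    rw [map_prod, Finset.prod_eq_zero_iff] at hzero
    obtain ⟨ε, -, hε⟩ := hzero
    rw [map_scaleBy] at hε
    refine scaleBy_ne_zero ?_ ?_ hε
    · intro k h0
      have h1 := congrArg φ (he ε k)
      rw [map_pow, map_one] at h1
      have h0' : φ (e ε k) = 0 := h0
      rw [h0', zero_pow Fintype.card_ne_zero] at h1
      exact zero_ne_one h1
    · refine ne_zero_iff.mpr ⟨s, ?_⟩
      rw [coeff_map, coeff_map]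
      exact fun h => hs (Ideal.Quotient.eq_zero_iff_mem.mp h)

theorem prod_subgroup_sq (Γ : Subgroup (Fin m → ℂˣ)) [Fintype Γ] :
    (∏ ε : Γ, (ε : Fin m → ℂˣ)) ^ 2 = 1 := by
  have h : ∏ ε : Γ, ((ε⁻¹ : Γ) : Fin m → ℂˣ) = ∏ ε : Γ, (ε : Fin m → ℂˣ) :=
    Fintype.prod_equiv (Equiv.inv Γ) _ _ fun _ => rfl
  rw [sq]
  nth_rewrite 1 [← h]
  rw [← Finset.prod_mul_distrib]
  simp

/-- The lexicographic leading coefficient works: it is a power of that of D times a monomial in the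
product of all elements of Γ. Inversion permutes Γ, so that product squares to 1 and the monomial is
±1. -/
theorem exists_integer_coeff (Γ : Subgroup (Fin m → ℂˣ)) [Fintype Γ]
    {D : MvPolynomial (Fin m) ℤ} (hD : toComplex D ≠ 0) :
    ∃ (s : Fin m →₀ ℕ) (b : ℤ), b ≠ 0 ∧
      (∏ ε : Γ, scale (ε : Fin m → ℂˣ) (toComplex D)).coeff s = b := by
  let ord : MonomialOrder (Fin m) := MonomialOrder.lex
  set f := toComplex D with hf
  set d := ord.degree f with hd
  have hdeg : ∀ ε : Fin m → ℂˣ, ord.degree (scale ε f) = d := by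
    intro ε
    have hs : (scale ε f).support = f.support := by
      ext s
      rw [mem_support_iff, mem_support_iff, scale_eq_scaleBy, coeff_scaleBy]
      have : ∏ i, (ε i : ℂ) ^ s i ≠ 0 :=
        Finset.prod_ne_zero_iff.mpr fun i _ => pow_ne_zero _ (Units.ne_zero _)
      simp [this]
    rw [hd, MonomialOrder.degree, MonomialOrder.degree, hs]
  have hlc : ∀ ε : Fin m → ℂˣ,
      ord.leadingCoeff (scale ε f) = ((∏ i, ε i ^ d i : ℂˣ) : ℂ) * D.coeff d := by
    intro ε
    rw [MonomialOrder.leadingCoeff, hdeg, scale_eq_scaleBy, coeff_scaleBy, hf, toComplex, coeff_map]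
    simp
  have hDd : D.coeff d ≠ 0 := by
    have h1 : ord.leadingCoeff f ≠ 0 := ord.leadingCoeff_ne_zero_iff.mpr hD
    rw [MonomialOrder.leadingCoeff, ← hd, hf, toComplex, coeff_map] at h1
    intro h0
    rw [h0, map_zero] at h1
    exact h1 rfl
  have hprod : ord.leadingCoeff (∏ ε : Γ, scale (ε : Fin m → ℂˣ) f) =
      ((∏ i, (∏ ε : Γ, (ε : Fin m → ℂˣ)) i ^ d i : ℂˣ) : ℂ) * D.coeff d ^ Fintype.card Γ := by
    have h1 : ∀ t : Finset Γ, ord.leadingCoeff (∏ ε ∈ t, scale (ε : Fin m → ℂˣ) f) =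
        ∏ ε ∈ t, ord.leadingCoeff (scale (ε : Fin m → ℂˣ) f) := by
      classical
      intro t
      induction t using Finset.induction_on with
      | empty => simp
      | insert a t ha ih =>
        rw [Finset.prod_insert ha, Finset.prod_insert ha, MonomialOrder.leadingCoeff_mul, ih]
    rw [h1]
    simp only [hlc, Finset.prod_mul_distrib, Finset.prod_const, Finset.card_univ]
    congr 1
    rw [← Units.coe_prod, Finset.prod_comm]
    simp only [Finset.prod_pow, Finset.prod_apply]
  have hsq : ((∏ i, (∏ ε : Γ, (ε : Fin m → ℂˣ)) i ^ d i : ℂˣ) : ℂ) ^ 2 = 1 := by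
    rw [← Units.val_pow_eq_pow_val, ← Finset.prod_pow]
    have : ∀ i, ((∏ ε : Γ, (ε : Fin m → ℂˣ)) i ^ d i) ^ 2 = 1 := by
      intro i
      have h2 := congrFun (prod_subgroup_sq Γ) i
      rw [← pow_mul, mul_comm, pow_mul]
      rw [Pi.pow_apply] at h2
      rw [h2, Pi.one_apply, one_pow]
    simp only [this, Finset.prod_const_one, Units.val_one]
  refine ⟨ord.degree (∏ ε : Γ, scale (ε : Fin m → ℂˣ) f), ?_⟩
  rw [MonomialOrder.leadingCoeff] at hprod
  rcases eq_or_eq_neg_of_sq_eq_sq _ 1 (hsq.trans (one_pow 2).symm) with h | h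
  · exact ⟨D.coeff d ^ Fintype.card Γ, pow_ne_zero _ hDd, by rw [hprod, h]; push_cast; ring⟩
  · exact ⟨-D.coeff d ^ Fintype.card Γ, neg_ne_zero.mpr (pow_ne_zero _ hDd), by
      rw [hprod, h]; push_cast; ring⟩

theorem coeff_monoMap_mulVec {M : Matrix (Fin m) (Fin m) ℤ}
    (hM : Function.Injective M.mulVec) (h : Laurent m) (x : Fin m → ℤ) :
    (monoMap M h).coeff (M.mulVec x) = h.coeff x := by
  classical
  induction h using AddMonoidAlgebra.induction_linear with
  | zero => simp
  | add p q hp hq => simp [hp, hq]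
  | single v a =>
    rw [monoMap_single, AddMonoidAlgebra.coeff_single, AddMonoidAlgebra.coeff_single,
      Finsupp.single_apply, Finsupp.single_apply]
    simp only [hM.eq_iff]

theorem coeff_toLaurent_mem {A : Type*} [SetLike A ℂ] [ZeroMemClass A ℂ] (T : A)
    {f : MvPolynomial (Fin m) ℂ} (hf : ∀ s, f.coeff s ∈ T) (w : Fin m → ℤ) :
    (toLaurent f).coeff w ∈ T := by
  by_cases hw : w ∈ Set.range (castExp (m := m))
  · obtain ⟨s, rfl⟩ := hw
    rw [coeff_toLaurent]
    exact hf s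
  · rw [coeff_toLaurent_of_notMem_range f hw]
    exact zero_mem T

theorem constant_eq_one_or_eq_neg_one {M : Matrix (Fin m) (Fin m) ℤ}
    (hM : Function.Injective M.mulVec) [Fintype (G M)] {D₁ D₂ : MvPolynomial (Fin m) ℤ}
    (h₁ : (D₁.support.gcd fun s => D₁.coeff s) = 1) (h₂ : (D₂.support.gcd fun s => D₂.coeff s) = 1)
    {v : Fin m → ℤ} {c : ℂ}
    (h : compAlpha M (toComplex D₁) = AddMonoidAlgebra.single v c *
      toLaurent (∏ ε : G M, scale (ε : Fin m → ℂˣ) (toComplex D₂))) : c = 1 ∨ c = -1 := by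
  have hprim : ∀ D : MvPolynomial (Fin m) ℤ, (D.support.gcd fun s => D.coeff s) = 1 →
      ∀ p : ℕ, p.Prime → ∃ s, ¬ (p : ℤ) ∣ D.coeff s := by
    intro D hD p hp
    by_contra! hall
    have h1 : (p : ℤ) ∣ 1 := by
      rw [← hD]
      exact Finset.dvd_gcd fun s _ => hall s
    exact hp.one_lt.ne' (by simpa using Int.isUnit_iff.mp (isUnit_of_dvd_one h1))
  obtain ⟨P, hP, hPprim⟩ := exists_integral_model (G M) D₂
  set Q := ∏ ε : G M, scale (ε : Fin m → ℂˣ) (toComplex D₂) with hQ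
  have hcoeff : ∀ w, (compAlpha M (toComplex D₁)).coeff (v + w) = c * (toLaurent Q).coeff w := by
    intro w
    rw [h, AddMonoidAlgebra.coeff_single_mul_apply, neg_add_cancel_left]
  have hA : ∀ w, ∃ a : ℤ, (a : ℂ) = (compAlpha M (toComplex D₁)).coeff w := by
    intro w
    rw [compAlpha_eq_monoMap]
    by_cases hw : w ∈ columnLattice M
    · obtain ⟨x, rfl⟩ := mem_columnLattice_iff.mp hw
      rw [coeff_monoMap_mulVec hM]
      have hr : ∀ s, (toComplex D₁).coeff s ∈ (Int.castRingHom ℂ).range :=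
        fun s => ⟨D₁.coeff s, (coeff_map _ _ _).symm⟩
      exact coeff_toLaurent_mem (Int.castRingHom ℂ).range hr x
    · exact ⟨0, by rw [coeff_eq_zero_of_notMem _ hw, Int.cast_zero]⟩
  have hB : ∀ w, ∃ b : integralClosure ℤ ℂ, (b : ℂ) = (toLaurent Q).coeff w := by
    intro w
    have := coeff_toLaurent_mem (integralClosure ℤ ℂ) (f := Q)
      (fun s => by rw [← hP, coeff_map]; exact (P.coeff s).2) w
    exact ⟨⟨_, this⟩, rfl⟩
  choose A hA using hA
  choose B hB using hB
  have hBP : ∀ s, B (castExp s) = P.coeff s := by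
    intro s
    apply Subtype.ext
    rw [hB, coeff_toLaurent, ← hP, coeff_map]
    rfl
  have hD₂ : toComplex D₂ ≠ 0 := by
    obtain ⟨s, hs⟩ := hprim D₂ h₂ 2 Nat.prime_two
    refine ne_zero_iff.mpr ⟨s, ?_⟩
    rw [toComplex, coeff_map]
    intro h0
    have : D₂.coeff s = 0 := Int.cast_eq_zero.mp h0
    exact hs (by rw [this]; exact dvd_zero _)
  refine eq_one_or_eq_neg_one_of_primitive (fun w => A (v + w)) B ?_ ?_ ?_ ?_
  · intro w
    rw [hA, hB, hcoeff]
  · intro p hp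
    obtain ⟨s, hs⟩ := hprim D₁ h₁ p hp
    refine ⟨-v + M.mulVec (castExp s), ?_⟩
    have : A (M.mulVec (castExp s)) = D₁.coeff s := by
      have h1 := hA (M.mulVec (castExp s))
      rw [compAlpha_eq_monoMap, coeff_monoMap_mulVec hM, coeff_toLaurent, toComplex, coeff_map] at h1
      exact Int.cast_injective h1
    rwa [add_neg_cancel_left, this]
  · intro 𝔭 h𝔭 p hp hmem
    obtain ⟨s, hs⟩ := hprim D₂ h₂ p hp
    obtain ⟨t, ht⟩ := hPprim 𝔭 h𝔭 ⟨s, by rwa [intCast_mem_iff h𝔭 hp hmem]⟩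
    exact ⟨castExp t, by rwa [hBP]⟩
  · obtain ⟨s, b, hb, hsb⟩ := exists_integer_coeff (G M) hD₂
    exact ⟨castExp s, b, hb, by rw [hB, coeff_toLaurent, hsb]⟩

/-! ### Multiplicity one and the conclusion -/

theorem emultiplicity_factor {ι : Type*} {s : Finset ι} {p : ι → MvPolynomial (Fin m) ℂ}
    {i : ι} (hi : i ∈ s) (hp : Prime (p i)) (hX : ∀ k, ¬ p i ∣ X k)
    (hrel : ∀ j ∈ s, j ≠ i → ¬ p i ∣ p j) {u : Laurent m} (hu : IsUnit u) :
    emultiplicity (toLaurent (p i)) (u * toLaurent (∏ j ∈ s, p j)) = 1 := by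
  classical
  have h1 := emultiplicity_eq_coe (a := toLaurent (p i)) (b := u * toLaurent (∏ j ∈ s, p j)) (n := 1)
  rw [Nat.cast_one] at h1
  rw [h1, hu.dvd_mul_left, hu.dvd_mul_left, pow_one]
  refine ⟨map_dvd _ (Finset.dvd_prod_of_mem p hi), ?_⟩
  rw [← Finset.mul_prod_erase s p hi, map_mul, one_add_one_eq_two, sq]
  have hne : toLaurent (p i) ≠ 0 := by
    rw [Ne, ← map_zero toLaurent, toLaurent_injective.eq_iff]
    exact hp.ne_zero
  rw [mul_dvd_mul_iff_left hne, toLaurent_dvd_toLaurent_iff hp hX, hp.dvd_finsetProd_iff]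
  rintro ⟨j, hj, hd⟩
  rw [Finset.mem_erase] at hj
  exact hrel j hj.2 hj.1 hd

end HornKapranov

theorem mainTheorem2 (n m : ℕ) (hmn : m ≤ n)
    (C₁ C₂ : Matrix (Fin n) (Fin m) ℤ) (M : Matrix (Fin m) (Fin m) ℤ)
    (hrow₁ : ∀ i, C₁ i ≠ 0) (hrow₂ : ∀ i, C₂ i ≠ 0)
    (hreg₁ : HornKapranov.IsRegular C₁) (hreg₂ : HornKapranov.IsRegular C₂)
    (hnd₁ : HornKapranov.NonDefective C₁) (hnd₂ : HornKapranov.NonDefective C₂)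
    (hM : C₁ = C₂ * M) :
    -- the group is finite, and the two descriptions of the lattice agree
    Finite (HornKapranov.G M) ∧
    (∀ w : Fin m → ℤ,
      w ∈ HornKapranov.columnLattice M ↔ ∀ ε ∈ HornKapranov.G M, ∏ i, ε i ^ w i = 1) ∧
    -- the two discriminants exist
    (∃ Δ₁, HornKapranov.IsDiscriminant C₁ Δ₁) ∧
    (∃ Δ₂, HornKapranov.IsDiscriminant C₂ Δ₂) ∧
    -- the factorization, for any choice of their signs
    ∀ Δ₁ Δ₂ : MvPolynomial (Fin m) ℤ,
      HornKapranov.IsDiscriminant C₁ Δ₁ → HornKapranov.IsDiscriminant C₂ Δ₂ →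
      (∃ v ∈ HornKapranov.columnLattice M, ∃ s : ℤ, (s = 1 ∨ s = -1) ∧
        HornKapranov.compAlpha M (HornKapranov.toComplex Δ₁) =
          (s : HornKapranov.Laurent m) * HornKapranov.mono v *
            ∏ᶠ ε : HornKapranov.G M, HornKapranov.toLaurent
              (HornKapranov.scale (ε : Fin m → ℂˣ) (HornKapranov.toComplex Δ₂))) ∧
      (∀ ε ∈ HornKapranov.G M, ∀ ε' ∈ HornKapranov.G M, ε ≠ ε' →
        IsRelPrime (HornKapranov.scale ε (HornKapranov.toComplex Δ₂))
          (HornKapranov.scale ε' (HornKapranov.toComplex Δ₂))) ∧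
      (∀ ε ∈ HornKapranov.G M,
        emultiplicity
          (HornKapranov.toLaurent
            (HornKapranov.scale ε (HornKapranov.toComplex Δ₂)))
          (HornKapranov.compAlpha M (HornKapranov.toComplex Δ₁)) = 1) := by
  open HornKapranov in
  subst hM
  obtain ⟨F₁, hF₁, hker₁⟩ := exists_irreducible_ker_eq_span hrow₁ hnd₁
  obtain ⟨F₂, hF₂, hker₂⟩ := exists_irreducible_ker_eq_span hrow₂ hnd₂
  -- The kernel of M lies in that of C₂M, which is trivial; this is where det M ≠ 0 comes from.
  have hzero : ∀ x, M.mulVec x = 0 → x = 0 := fun x hx =>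
    mulVec_injective_of_ker_eq_span hmn hrow₁ hreg₁ hF₁ hker₁
      (by rw [← Matrix.mulVec_mulVec, hx, Matrix.mulVec_zero])
  have hdet : M.det ≠ 0 := by
    intro h0
    obtain ⟨x, hx, hMx⟩ := Matrix.exists_mulVec_eq_zero_iff.mpr h0
    exact hx (hzero x hMx)
  have hinj : Function.Injective M.mulVec := by
    intro x y hxy
    rw [← sub_eq_zero]
    apply hzero
    rw [Matrix.mulVec_sub, sub_eq_zero]
    exact hxy
  have hfin := finite_G hdet
  have := Fintype.ofFinite (G M)
  refine ⟨hfin, mem_columnLattice_iff_forall_G hdet, exists_isDiscriminant hrow₁ hF₁ hker₁,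
    exists_isDiscriminant hrow₂ hF₂ hker₂, fun Δ₁ Δ₂ h₁ h₂ => ?_⟩
  have hk₁ := ker_eq_span_of_isDiscriminant hrow₁ h₁
  have hk₂ := ker_eq_span_of_isDiscriminant hrow₂ h₂
  obtain ⟨v, hv, c, hc, hfac⟩ := exists_unit_factorization hrow₂ hrow₁ hreg₂ hdet h₂.1 hk₁ hk₂
  have hrel : ∀ ε ∈ G M, ∀ ε' ∈ G M, ε ≠ ε' →
      IsRelPrime (scale ε (toComplex Δ₂)) (scale ε' (toComplex Δ₂)) :=
    fun ε _ ε' _ hne => isRelPrime_scale hrow₂ hreg₂ h₂.1 hk₂ hne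
  refine ⟨⟨v, hv, ?_⟩, hrel, ?_⟩
  · rw [finprod_eq_prod_of_fintype, ← map_prod, hfac]
    rcases constant_eq_one_or_eq_neg_one hinj h₁.2.2 h₂.2.2 hfac with rfl | rfl
    · exact ⟨1, Or.inl rfl, by rw [Int.cast_one, one_mul, mono]⟩
    · exact ⟨-1, Or.inr rfl, by
        rw [Int.cast_neg, Int.cast_one, neg_one_mul, mono, AddMonoidAlgebra.single_neg]⟩
  · intro ε hε
    have hu : IsUnit (AddMonoidAlgebra.single v c : Laurent m) := by
      refine IsUnit.of_mul_eq_one (AddMonoidAlgebra.single (-v) c⁻¹) ?_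
      rw [AddMonoidAlgebra.single_mul_single, add_neg_cancel, mul_inv_cancel₀ hc]
      rfl
    rw [hfac]
    refine emultiplicity_factor (p := fun ε : G M => scale (ε : Fin m → ℂˣ) (toComplex Δ₂))
      (i := ⟨ε, hε⟩) (Finset.mem_univ _) (prime_scale h₂.1.prime ε)
      (not_scale_dvd_X hrow₂ hk₂ ε) (fun ε' _ hne => ?_) hu
    rw [← (prime_scale h₂.1.prime ε).irreducible.isRelPrime_iff_not_dvd]
    exact hrel ε hε ε' ε'.2 fun h => hne (Subtype.ext h.symm)
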